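/- Setting. Let $G=(V,E)$ be a finite simple graph with $n=|V|\ge 1$ vertices, and let $T$ be a set of triangles of $G$ such that every vertex lies in at least one triangle of $T$ (for example, $G$ a triangular lattice graph). For each $v$ fix a neighbour $u(v)$ of $v$ and an angle $\theta_v\in[0,\pi/2]$. Put $N_G=3|V|+|T|$, let $\mathbf A$ be the adjacency matrix of $G$, and let $1_v$ be the indicator vector of $v$. A family of provers indexed by $V$ consists of a unit vector $|\psi'\rangle$ in a complex Hilbert space of arbitrary dimension and, for each $v\in V$ and each of the four queries $X, Z, R(\theta_v), R(-\theta_v)$, a self-adjoint operator squaring to the identity (a $\pm1$ observable), such that observables of different provers commute (in particular, observables acting on different tensor factors are allowed). The honest provers hold the graph state $|G\rangle=2^{-n/2}\sum_{x\in\{0,1\}^n}(-1)^{e(x)}|x\rangle$, where $e(x)$ is the number of edges of $G$ both of whose ends have bit $1$ in $x$, and prover $v$ measures qubit $v$ with the Pauli matrices $X$, $Z$ and with $R(\pm\theta_v)=\cos(\pm\theta_v)X+\sin(\pm\theta_v)Z$. One-shot test. A query assigns to some of the provers one of their inputs; the other provers are ignored and their reply counts as $1$. The verifier does one of the following. - With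 probability $|V|/N_G$: choose $v\in V$ uniformly, query according to $X_vZ^{\mathbf A1_v}$, and accept iff the product of the replies is $1$. - With probability $|T|/N_G$: choose a triangle in $T$ uniformly, with characteristic vector $\tau$, query according to $X^{\tau}Z^{\mathbf A\tau}$ (with $\mathbf A\tau$ mod $2$), and accept iff the product is $-1$. - With probability $2|V|/N_G$: choose $t\in\{1,-1\}$ and $v\in V$ uniformly, and let $u=u(v)$. With probability $\frac{\cos\theta_v}{\cos\theta_v+|\sin\theta_v|}$ query $R_v(t\theta_v)Z^{\mathbf A1_v}$ and accept iff the product is $1$; otherwise query $R_v(t\theta_v)X_uZ^{\mathbf A1_u\oplus1_v}$ and accept iff $t$ times the product is $1$. An adaptive measurement pattern queries provers one after another, each at most once, where the next prover and its query, the decision to stop, and the final classical outcome are functions of the replies obtained so far. Statement. 1. For the honest provers the one-shot test accepts with probability $$c_{test}=\frac{2|V|+|T|+\sum_{v}\frac{1}{\cos\theta_v+|\sin\theta_v|}}{N_G}.$$ 2. For arbitrary provers and every $\delta\ge 0$: if for some adaptive measurement pattern and some final outcome the probability of that outcome differs from its probability for the honest provers by more than $\delta$, then the one-shot test accepts these provers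 with probability at most $$s_{test}=c_{test}-\frac{\delta^{8}}{10^{17.7}\,n^{11}}.$$ -/

import Mathlib

open scoped Matrix

namespace OneShotTest

/-- The four queries that a prover can receive: `X`, `Z`, and `R t` for `t = ±1`, the latter
asking for a measurement at angle `t * θ v`. -/
inductive Query where
  | X : Query
  | Z : Query
  | R (t : ℤˣ) : Query

/-- A family of non-communicating quantum provers indexed by `V`: a joint pure state in a Hilbert
space `H` (of any dimension), and for each prover and query a `±1`-valued observable, where
observables of different provers commute.  This includes all strategies in which `H` is a tensor
product of spaces `H v` and the observables of prover `v` act on the factor `H v` only. -/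
structure Provers (V : Type*) (H : Type*) [NormedAddCommGroup H] [InnerProductSpace ℂ H]
    [CompleteSpace H] where
  state : H
  norm_state : ‖state‖ = 1
  obs : V → Query → H →L[ℂ] H
  obs_selfAdjoint : ∀ v b, IsSelfAdjoint (obs v b)
  obs_sq : ∀ v b, obs v b * obs v b = 1
  obs_commute : ∀ v w b c, v ≠ w → Commute (obs v b) (obs w c)

/-- An adaptive measurement pattern, as a decision tree: either stop with a final classical outcome,
or put the query `b` to prover `v` and continue in dependence on the reply `±1`. -/
inductive Pattern (V : Type*) (Ω : Type*) where
  | output (x : Ω) : Pattern V Ω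
  | measure (v : V) (b : Query) (next : ℤˣ → Pattern V Ω) : Pattern V Ω

/-- Along every branch each prover is queried at most once, and none of the provers in `used`. -/
def Pattern.QueriesOnce {V Ω : Type*} : Pattern V Ω → Set V → Prop
  | .output _, _ => True
  | .measure v _ next, used => v ∉ used ∧ ∀ a, (next a).QueriesOnce (insert v used)

namespace Provers

variable {V H : Type*} [NormedAddCommGroup H] [InnerProductSpace ℂ H] [CompleteSpace H]

/-- The spectral projection `(1 + a M) / 2` of the observable `M` of prover `v` for query `b`,
belonging to the reply `a = ±1`. -/
noncomputable def proj (P : Provers V H) (v : V) (b : Query) (a : ℤˣ) : H →L[ℂ] H :=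
  (1 / 2 : ℂ) • (1 + ((a : ℤ) : ℂ) • P.obs v b)

open Classical in
/-- Born rule for sequential projective measurements: the total squared norm of the (unnormalised)
final vectors of the branches ending in `x`, starting from the vector `φ`. -/
noncomputable def weight {Ω : Type*} (P : Provers V H) (x : Ω) : Pattern V Ω → H → ℝ
  | .output y, φ => if y = x then ‖φ‖ ^ 2 else 0
  | .measure v b next, φ => ∑ a : ℤˣ, P.weight x (next a) (P.proj v b a φ)

/-- The probability that the pattern `p`, carried out with the provers `P`, has final outcome `x`. -/
noncomputable def outcomeProb {Ω : Type*} (P : Provers V H) (p : Pattern V Ω) (x : Ω) : ℝ :=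
  P.weight x p P.state

end Provers

/-- Put the non-adaptive queries `q` to the provers in the list and output `s` times the product of
the replies; a prover with query `none` is ignored, which counts as the reply `1`. -/
def productPattern {V : Type*} (q : V → Option Query) : List V → ℤˣ → Pattern V ℤˣ
  | [], s => .output s
  | v :: l, s =>
    match q v with
    | none => productPattern q l s
    | some b => .measure v b fun a => productPattern q l (s * a)

section Test

variable {V : Type*} [Fintype V] [DecidableEq V]

/-- The probability that the product of the replies to the queries `q` equals `s`. -/
noncomputable def productProb {H : Type*} [NormedAddCommGroup H] [InnerProductSpace ℂ H]
    [CompleteSpace H] (P : Provers V H) (q : V → Option Query) (s : ℤˣ) : ℝ :=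
  P.outcomeProb (productPattern q Finset.univ.toList 1) s

variable (G : SimpleGraph V) [DecidableRel G.Adj]

/-- `X` on `v` and `Z` on the neighbours of `v`. -/
def vertexQuery (v : V) : V → Option Query := fun w =>
  if w = v then some .X else if G.Adj v w then some .Z else none

/-- `X` on the vertices of the triangle `τ`, and `Z` on the other vertices that have an odd number
of neighbours in `τ` (vertices of a triangle have two). -/
def triangleQuery (τ : Finset V) : V → Option Query := fun w =>
  if w ∈ τ then some .X else if Odd (τ.filter (G.Adj w)).card then some .Z else none

/-- `R(tθ)` on `v` and `Z` on the neighbours of `v`. -/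
def rXQuery (v : V) (t : ℤˣ) : V → Option Query := fun w =>
  if w = v then some (.R t) else if G.Adj v w then some .Z else none

/-- `R(tθ)` on `v`, `X` on `u`, and `Z` on the neighbours of `u` other than `v`. -/
def rZQuery (v u : V) (t : ℤˣ) : V → Option Query := fun w =>
  if w = v then some (.R t) else if w = u then some .X else if G.Adj u w then some .Z else none

/-- The number of subtests, `N_G = 3|V| + |T|`. -/
def numSubtests (T : Finset (Finset V)) : ℕ := 3 * Fintype.card V + T.card

/-- The probability that the one-shot test accepts the provers `P`.  Here `T` is the set of
triangles, `nb v` is the neighbour of `v` that is used in the subtests of `R(±θ v)`. -/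
noncomputable def acceptProb (T : Finset (Finset V)) (nb : V → V) (θ : V → ℝ) {H : Type*}
    [NormedAddCommGroup H] [InnerProductSpace ℂ H] [CompleteSpace H] (P : Provers V H) : ℝ :=
  let n : ℝ := Fintype.card V
  let m : ℝ := T.card
  let N : ℝ := numSubtests T
  n / N * ∑ v, 1 / n * productProb P (vertexQuery G v) 1 +
  m / N * ∑ τ ∈ T, 1 / m * productProb P (triangleQuery G τ) (-1) +
  2 * n / N * ∑ t : ℤˣ, 1 / 2 * ∑ v, 1 / n *
    (Real.cos (θ v) / (Real.cos (θ v) + |Real.sin (θ v)|) * productProb P (rXQuery G v t) 1 +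
     |Real.sin (θ v)| / (Real.cos (θ v) + |Real.sin (θ v)|) *
      productProb P (rZQuery G v (nb v) t) t)

/-- The acceptance probability of honest provers. -/
noncomputable def cTest (T : Finset (Finset V)) (θ : V → ℝ) : ℝ :=
  (2 * (Fintype.card V : ℝ) + T.card +
    ∑ v, 1 / (Real.cos (θ v) + |Real.sin (θ v)|)) / numSubtests T

end Test

section Honest

variable {V : Type*} [Fintype V] [DecidableEq V]

/-- The state space of qubits labelled by `V`; the computational basis is indexed by bit strings. -/
abbrev Qubits (V : Type*) [Fintype V] : Type _ := EuclideanSpace ℂ (V → Fin 2)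

/-- The tensor product `⨂ v, A v` of one-qubit matrices. -/
def tensorOp : (V → Matrix (Fin 2) (Fin 2) ℂ) →* Matrix (V → Fin 2) (V → Fin 2) ℂ where
  toFun A := Matrix.of fun x y => ∏ v, A v (x v) (y v)
  map_one' := by
    ext x y
    simp only [Matrix.of_apply, Pi.one_apply, Matrix.one_apply]
    rw [Finset.prod_ite_zero]
    simp [funext_iff]
  map_mul' A B := by
    ext x y
    simp only [Matrix.of_apply, Pi.mul_apply, Matrix.mul_apply]
    rw [Finset.prod_univ_sum]
    simp [Finset.prod_mul_distrib]

/-- The one-qubit matrix `M` acting on qubit `v`. -/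
def localOp (v : V) (M : Matrix (Fin 2) (Fin 2) ℂ) : Matrix (V → Fin 2) (V → Fin 2) ℂ :=
  tensorOp (Pi.mulSingle v M)

/-- The ideal one-qubit observable for each query, at angle `θ`: `X`, `Z`, and
`R(tθ) = cos(tθ) X + sin(tθ) Z`. -/
noncomputable def idealObs (θ : ℝ) : Query → Matrix (Fin 2) (Fin 2) ℂ
  | .X => !![0, 1; 1, 0]
  | .Z => !![1, 0; 0, -1]
  | .R t => (Real.cos ((t : ℤ) * θ) : ℂ) • !![0, 1; 1, 0] +
      (Real.sin ((t : ℤ) * θ) : ℂ) • !![1, 0; 0, -1]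

open Classical in
/-- The graph state of `G`: the amplitude at the bit string `x` is `2^(-n/2)` times `-1` to the
number of edges of `G` between vertices with bit `1`. -/
noncomputable def graphState (G : SimpleGraph V) : Qubits V :=
  WithLp.toLp 2 fun x =>
    (-1 : ℂ) ^ (G.edgeFinset.filter fun e => ∀ v ∈ e, x v = 1).card /
      (Real.sqrt (2 ^ Fintype.card V) : ℂ)

theorem norm_graphState (G : SimpleGraph V) : ‖graphState G‖ = 1 := by
  classical
  rw [EuclideanSpace.norm_eq, Real.sqrt_eq_one]
  simp [graphState, Finset.card_univ, abs_of_nonneg]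

theorem idealObs_conjTranspose (θ : ℝ) (b : Query) : (idealObs θ b)ᴴ = idealObs θ b := by
  cases b <;> ext i j <;> fin_cases i <;> fin_cases j <;>
    simp [idealObs, Matrix.conjTranspose_apply, -Complex.ofReal_cos, -Complex.ofReal_sin]

theorem idealObs_sq (θ : ℝ) (b : Query) : idealObs θ b * idealObs θ b = 1 := by
  cases b with
  | X => ext i j; fin_cases i <;> fin_cases j <;> simp [idealObs, Matrix.mul_apply]
  | Z => ext i j; fin_cases i <;> fin_cases j <;> simp [idealObs, Matrix.mul_apply]
  | R t =>
    have h := Complex.sin_sq_add_cos_sq (((t : ℤ) : ℂ) * (θ : ℂ))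
    ext i j
    fin_cases i <;> fin_cases j <;> simp [idealObs, Matrix.mul_apply] <;>
      first | linear_combination h | ring

theorem localOp_conjTranspose (v : V) (M : Matrix (Fin 2) (Fin 2) ℂ) :
    (localOp v M)ᴴ = localOp v Mᴴ := by
  ext x y
  simp only [localOp, tensorOp, Matrix.conjTranspose_apply, MonoidHom.coe_mk, OneHom.coe_mk,
    Matrix.of_apply, star_prod]
  refine Finset.prod_congr rfl fun w _ => ?_
  by_cases h : w = v
  · subst h; simp
  · simp [Pi.mulSingle_eq_of_ne h, Matrix.one_apply, eq_comm, apply_ite star]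

theorem localOp_mul (v : V) (M N : Matrix (Fin 2) (Fin 2) ℂ) :
    localOp v M * localOp v N = localOp v (M * N) := by
  rw [localOp, localOp, ← map_mul, ← Pi.mulSingle_mul, localOp]

/-- The honest provers: they share the graph state, and each measures its own qubit as asked. -/
noncomputable def honest (G : SimpleGraph V) (θ : V → ℝ) : Provers V (Qubits V) where
  state := graphState G
  norm_state := norm_graphState G
  obs v b := Matrix.toEuclideanCLM (𝕜 := ℂ) (localOp v (idealObs (θ v) b))
  obs_selfAdjoint v b := by
    rw [IsSelfAdjoint, ← map_star, Matrix.star_eq_conjTranspose, localOp_conjTranspose,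
      idealObs_conjTranspose]
  obs_sq v b := by
    rw [← map_mul, localOp_mul, idealObs_sq, localOp, Pi.mulSingle_one, map_one, map_one]
  obs_commute v w b c h :=
    ((Pi.mulSingle_commute (f := fun _ : V => Matrix (Fin 2) (Fin 2) ℂ) h _ _).map tensorOp).map
      (Matrix.toEuclideanCLM (𝕜 := ℂ) (n := V → Fin 2))

end Honest

end OneShotTest

namespace OneShotTest

/-! Scaled by the number of subtests, the deficit `cTest - acceptProb` is exactly a sum of squared
errors (`deficit_eq`), one for each stabiliser relation, each triangle relation and each expansion
of `R(±θ)` in `X` and `Z`. All of them vanish for the honest provers, and a small deficit makes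
every relation hold approximately on the state. The three stabilisers of a triangle multiply to the
triangle operator times the group commutator `ZXZX` at one vertex (`qstr_triangle`), so the values
`1` and `-1` demanded by the test force `X` and `Z` of each covered vertex nearly to anticommute on
the state (`norm_anticommutator_le`).

One ancilla qubit per prover makes this exact. Let `X = E + O`, where `E` commutes and `O`
anticommutes with `Z`. Then `E ⊗ X + O ⊗ 1` and `Z ⊗ Z` anticommute exactly. With the ancillas in
`|0⟩` the second acts as `Z`, and the first differs from `X` by at most the norm of the
anticommutator (`norm_extX_incl_sub_le`). A hybrid argument along the decision tree
(`abs_weight_sub_weight_le`) replaces the given observables by the exact ones and charges each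
prover once, whatever the number of branches.

For exact Pauli observables the stabilisers commute, and averaging over them yields a nearby common
fixed vector `g` (`IsPauli.exists_stabilised`). The qubits with their honest observables embed, up
to the scale `‖g‖`, so that the graph state goes to `g`; outcome probabilities on `g` are therefore
`‖g‖ ^ 2` times the honest ones (`IsPauli.weight_eq_honest`).

If the scaled deficit is at most `d ^ 2`, the losses add up to at most `600 n² d`, which is less
than `δ` for `d = δ / (1000 n²)`. The resulting gap, quadratic in `δ`, exceeds the claimed one
because `δ ≤ 1` and `N_G ≤ 4n³` (`gap_le`). -/

theorem sum_intUnits {M : Type*} [AddCommMonoid M] (f : ℤˣ → M) : ∑ a, f a = f 1 + f (-1) := by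
  rw [show (Finset.univ : Finset ℤˣ) = {1, -1} from by decide, Finset.sum_pair (by decide)]

/-! ### Outcome weights of decision trees. -/

namespace Provers

variable {V H : Type*} [NormedAddCommGroup H] [InnerProductSpace ℂ H] [CompleteSpace H]
  (P : Provers V H)

theorem inner_obs (v : V) (b : Query) (φ χ : H) :
    inner ℂ (P.obs v b φ) χ = inner ℂ φ (P.obs v b χ) :=
  (ContinuousLinearMap.isSelfAdjoint_iff_isSymmetric.mp (P.obs_selfAdjoint v b)) φ χ

theorem obs_obs (v : V) (b : Query) (φ : H) : P.obs v b (P.obs v b φ) = φ := by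
  simpa using congrArg (fun A : H →L[ℂ] H => A φ) (P.obs_sq v b)

theorem norm_obs (v : V) (b : Query) (φ : H) : ‖P.obs v b φ‖ = ‖φ‖ := by
  have h : ‖P.obs v b φ‖ ^ 2 = ‖φ‖ ^ 2 := by
    rw [← inner_self_eq_norm_sq (𝕜 := ℂ), P.inner_obs, P.obs_obs, inner_self_eq_norm_sq]
  exact (sq_eq_sq₀ (norm_nonneg _) (norm_nonneg _)).mp h

theorem proj_apply (v : V) (b : Query) (a : ℤˣ) (φ : H) :
    P.proj v b a φ = (1 / 2 : ℂ) • (φ + ((a : ℤ) : ℂ) • P.obs v b φ) := by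
  simp [proj]

theorem norm_proj_sq (v : V) (b : Query) (a : ℤˣ) (φ : H) :
    ‖P.proj v b a φ‖ ^ 2 = (‖φ‖ ^ 2 + (a : ℤ) * (inner ℂ φ (P.obs v b φ)).re) / 2 := by
  rw [proj_apply, norm_smul, mul_pow, @norm_add_sq ℂ, norm_smul, norm_obs, inner_smul_right]
  rcases Int.units_eq_one_or a with rfl | rfl <;> simp <;> ring

theorem sum_norm_proj_sq (v : V) (b : Query) (φ : H) :
    ∑ a, ‖P.proj v b a φ‖ ^ 2 = ‖φ‖ ^ 2 := by
  rw [sum_intUnits]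
  simp only [norm_proj_sq]
  push_cast
  simp
  ring

theorem Commute.proj {v : V} {b : Query} {A : H →L[ℂ] H} (h : Commute A (P.obs v b)) (a : ℤˣ) :
    Commute A (P.proj v b a) :=
  ((Commute.one_right A).add_right (h.smul_right _)).smul_right _

theorem apply_proj {v : V} {b : Query} {A : H →L[ℂ] H} (h : Commute A (P.obs v b)) (a : ℤˣ)
    (φ : H) : A (P.proj v b a φ) = P.proj v b a (A φ) :=
  congrArg (fun B : H →L[ℂ] H => B φ) (Commute.proj P h a).eq

section Weight

variable {Ω : Type*} (x : Ω)

theorem weight_nonneg (p : Pattern V Ω) (φ : H) : 0 ≤ P.weight x p φ := by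
  induction p generalizing φ with
  | output y => rw [weight]; split_ifs <;> positivity
  | measure v b next ih => rw [weight]; exact Finset.sum_nonneg fun a _ => ih a _

theorem weight_le (p : Pattern V Ω) (φ : H) : P.weight x p φ ≤ ‖φ‖ ^ 2 := by
  induction p generalizing φ with
  | output y => rw [weight]; split_ifs <;> simp
  | measure v b next ih =>
    rw [weight, ← P.sum_norm_proj_sq v b φ]
    exact Finset.sum_le_sum fun a _ => ih a _

theorem outcomeProb_nonneg (p : Pattern V Ω) : 0 ≤ P.outcomeProb p x :=
  P.weight_nonneg x p _

theorem outcomeProb_le_one (p : Pattern V Ω) : P.outcomeProb p x ≤ 1 :=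
  (P.weight_le x p P.state).trans_eq (by rw [P.norm_state, one_pow])

/-- The square root of `weight` is a seminorm; this is the triangle inequality in quadratic form. -/
theorem weight_add_le (p : Pattern V Ω) (φ χ : H) {t : ℝ} (ht : 0 < t) :
    P.weight x p (φ + χ) ≤ (1 + t) * P.weight x p φ + (1 + 1 / t) * P.weight x p χ := by
  induction p generalizing φ χ with
  | output y =>
    simp only [weight]
    split_ifs
    · have h1 : ‖φ + χ‖ ^ 2 ≤ (‖φ‖ + ‖χ‖) ^ 2 := by gcongr; exact norm_add_le _ _
      -- Young's inequality `2ab ≤ t a² + b² / t`, as a completed square.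
      have h2 : 0 ≤ (t * ‖φ‖ - ‖χ‖) ^ 2 / t := by positivity
      have h3 : (t * ‖φ‖ - ‖χ‖) ^ 2 / t = t * ‖φ‖ ^ 2 - 2 * ‖φ‖ * ‖χ‖ + 1 / t * ‖χ‖ ^ 2 := by
        field_simp
        ring
      nlinarith
    · simp
  | measure v b next ih =>
    simp only [weight, map_add, Finset.mul_sum, ← Finset.sum_add_distrib]
    exact Finset.sum_le_sum fun a _ => ih a _ _

/-- The free parameter `t` will be the error scale `d`: if `‖φ - χ‖` is of order `d`, both terms on
the right are then of order `d`. -/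
theorem weight_sub_le (p : Pattern V Ω) (φ χ : H) {t : ℝ} (ht : 0 < t) :
    P.weight x p φ - P.weight x p χ ≤ t * P.weight x p χ + (1 + 1 / t) * ‖φ - χ‖ ^ 2 := by
  have h := P.weight_add_le x p χ (φ - χ) ht
  rw [add_sub_cancel] at h
  have := mul_le_mul_of_nonneg_left (P.weight_le x p (φ - χ)) (show 0 ≤ 1 + 1 / t by positivity)
  linarith

theorem abs_weight_sub_le (p : Pattern V Ω) (φ χ : H) {t : ℝ} (ht : 0 < t) (hφ : ‖φ‖ ≤ 1)
    (hχ : ‖χ‖ ≤ 1) :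
    |P.weight x p φ - P.weight x p χ| ≤ t + (1 + 1 / t) * ‖φ - χ‖ ^ 2 := by
  have h (φ : H) (hφ : ‖φ‖ ≤ 1) : t * P.weight x p φ ≤ t :=
    mul_le_of_le_one_right ht.le
      ((P.weight_le x p φ).trans (pow_le_one₀ (norm_nonneg _) hφ))
  have h1 := P.weight_sub_le x p φ χ ht
  have h2 := P.weight_sub_le x p χ φ ht
  rw [norm_sub_rev] at h2
  rw [abs_sub_le_iff]
  constructor <;> linarith [h φ hφ, h χ hχ]

/-- A multiple of an isometry that intertwines the observables preserves weights up to a factor. -/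
theorem weight_map {H' : Type*} [NormedAddCommGroup H'] [InnerProductSpace ℂ H'] [CompleteSpace H']
    (Q : Provers V H') (J : H →ₗ[ℂ] H') (κ : ℝ) (hJ : ∀ φ, ‖J φ‖ = κ * ‖φ‖)
    (hobs : ∀ v b φ, J (P.obs v b φ) = Q.obs v b (J φ)) (p : Pattern V Ω) (φ : H) :
    Q.weight x p (J φ) = κ ^ 2 * P.weight x p φ := by
  induction p generalizing φ with
  | output y => simp only [weight]; split_ifs <;> simp [hJ, mul_pow]
  | measure v b next ih =>
    simp only [weight, Finset.mul_sum]
    refine Finset.sum_congr rfl fun a _ => ?_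
    rw [← ih, proj_apply, proj_apply]
    simp [hobs]

end Weight

/-! ### Hybrid argument: exchanging the observables along a pattern. -/

section Hybrid

variable (Q : Provers V H)

/-- Total squared distance of the observables of prover `v` in two families on the vector `φ`. -/
noncomputable def obsDist (v : V) (φ : H) : ℝ :=
  ‖P.obs v .X φ - Q.obs v .X φ‖ ^ 2 + ‖P.obs v .Z φ - Q.obs v .Z φ‖ ^ 2 +
    ∑ t, ‖P.obs v (.R t) φ - Q.obs v (.R t) φ‖ ^ 2

theorem obsDist_nonneg (v : V) (φ : H) : 0 ≤ P.obsDist Q v φ := by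
  unfold obsDist; positivity

theorem norm_obs_sub_sq_le (v : V) (b : Query) (φ : H) :
    ‖P.obs v b φ - Q.obs v b φ‖ ^ 2 ≤ P.obsDist Q v φ := by
  have h (t : ℤˣ) : ‖P.obs v (.R t) φ - Q.obs v (.R t) φ‖ ^ 2 ≤
      ∑ t, ‖P.obs v (.R t) φ - Q.obs v (.R t) φ‖ ^ 2 :=
    Finset.single_le_sum (f := fun t => ‖P.obs v (.R t) φ - Q.obs v (.R t) φ‖ ^ 2)
      (fun _ _ => by positivity) (Finset.mem_univ t)
  unfold obsDist
  cases b with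
  | X => have := h 1; have := sq_nonneg ‖P.obs v (.R 1) φ - Q.obs v (.R 1) φ‖
         have := sq_nonneg ‖P.obs v .Z φ - Q.obs v .Z φ‖
         linarith
  | Z => have := h 1; have := sq_nonneg ‖P.obs v (.R 1) φ - Q.obs v (.R 1) φ‖
         have := sq_nonneg ‖P.obs v .X φ - Q.obs v .X φ‖
         linarith
  | R t => have := h t
           have := sq_nonneg ‖P.obs v .X φ - Q.obs v .X φ‖
           have := sq_nonneg ‖P.obs v .Z φ - Q.obs v .Z φ‖
           linarith

variable {P Q}

/-- A measurement by `v` commutes with the observables of `w` in both families, so it distributes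
the squared distance at `w` over the two replies without increasing it. -/
theorem sum_obsDist_proj (hPQ : ∀ v w b c, v ≠ w → Commute (P.obs v b) (Q.obs w c))
    {v w : V} (hvw : w ≠ v) (b : Query) (φ : H) :
    ∑ a, P.obsDist Q w (Q.proj v b a φ) = P.obsDist Q w φ := by
  have h (c : Query) : ∑ a, ‖P.obs w c (Q.proj v b a φ) - Q.obs w c (Q.proj v b a φ)‖ ^ 2 =
      ‖P.obs w c φ - Q.obs w c φ‖ ^ 2 := by
    rw [← Q.sum_norm_proj_sq v b]
    refine Finset.sum_congr rfl fun a _ => ?_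
    rw [Q.apply_proj (hPQ w v c b hvw), Q.apply_proj (Q.obs_commute w v c b hvw), map_sub]
  simp only [obsDist, Finset.sum_add_distrib, h]
  rw [Finset.sum_comm]
  simp only [h]

open Classical in
-- Induction on the tree, with `U` the set of provers already charged. The first projection of `P`
-- is exchanged for that of `Q` at the cost of the term of `v`. The subtrees are then compared on
-- the post-measurement vectors of `Q`, where squared norms and the distances at other provers add
-- up to their values on `φ`.
theorem abs_weight_sub_weight_le [Fintype V]
    (hPQ : ∀ v w b c, v ≠ w → Commute (P.obs v b) (Q.obs w c)) {t : ℝ} (ht : 0 < t)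
    {Ω : Type*} (x : Ω) (p : Pattern V Ω) (U : Set V) (hp : p.QueriesOnce U) (φ : H) :
    |P.weight x p φ - Q.weight x p φ| ≤
      ∑ v, if v ∈ U then 0 else t * ‖φ‖ ^ 2 + (1 + 1 / t) / 2 * P.obsDist Q v φ := by
  have ht' : 0 ≤ (1 + 1 / t) / 2 := by positivity
  induction p generalizing U φ with
  | output y =>
    simp only [weight, sub_self, abs_zero]
    refine Finset.sum_nonneg fun v _ => ?_
    have := P.obsDist_nonneg Q v φ
    split_ifs <;> positivity
  | measure v b next ih =>
    obtain ⟨hv, hnext⟩ := hp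
    have hsum : ∑ w, (if w ∈ U then 0 else
        t * ‖φ‖ ^ 2 + (1 + 1 / t) / 2 * P.obsDist Q w φ) =
        (t * ‖φ‖ ^ 2 + (1 + 1 / t) / 2 * P.obsDist Q v φ) +
        ∑ a, ∑ w, if w ∈ insert v U then 0 else
          t * ‖Q.proj v b a φ‖ ^ 2 + (1 + 1 / t) / 2 * P.obsDist Q w (Q.proj v b a φ) := by
      rw [Finset.sum_comm, Fintype.sum_eq_add_sum_compl v,
        Fintype.sum_eq_add_sum_compl (a := v) (f := fun w => ∑ a, _)]
      simp only [hv, if_false, Set.mem_insert_iff, true_or, if_true, Finset.sum_const_zero,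
        zero_add]
      congr 1
      refine Finset.sum_congr rfl fun w hw => ?_
      have hw : w ≠ v := by simpa using hw
      by_cases hU : w ∈ U
      · simp [hU]
      · simp only [hw, hU, or_self, if_false, Finset.sum_add_distrib, ← Finset.mul_sum,
          sum_obsDist_proj hPQ hw, sum_norm_proj_sq]
    rw [hsum]
    simp only [weight, ← Finset.sum_sub_distrib]
    have hsplit : ∑ a, (P.weight x (next a) (P.proj v b a φ) -
        Q.weight x (next a) (Q.proj v b a φ)) =
        ∑ a, (P.weight x (next a) (P.proj v b a φ) - P.weight x (next a) (Q.proj v b a φ)) +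
        ∑ a, (P.weight x (next a) (Q.proj v b a φ) - Q.weight x (next a) (Q.proj v b a φ)) := by
      rw [← Finset.sum_add_distrib]
      exact Finset.sum_congr rfl fun a _ => by ring
    rw [hsplit]
    refine (abs_add_le _ _).trans (add_le_add ?_ ?_)
    -- Projections differ by half the difference of the observables, hence `1 / 4`; the two replies
    -- together give the factor `1 / 2` of the bound.
    · have hdiff (a : ℤˣ) : ‖P.proj v b a φ - Q.proj v b a φ‖ ^ 2 ≤ 1 / 4 * P.obsDist Q v φ := by
        have : P.proj v b a φ - Q.proj v b a φ =
            (1 / 2 * ((a : ℤ) : ℂ)) • (P.obs v b φ - Q.obs v b φ) := by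
          rw [proj_apply, proj_apply]
          module
        rw [this, norm_smul, mul_pow]
        have := P.norm_obs_sub_sq_le Q v b φ
        have ha : ‖1 / 2 * ((a : ℤ) : ℂ)‖ ^ 2 = 1 / 4 := by
          rcases Int.units_eq_one_or a with rfl | rfl <;> norm_num
        rw [ha]
        linarith
      have hdiff' (a : ℤˣ) : ‖Q.proj v b a φ - P.proj v b a φ‖ ^ 2 ≤ 1 / 4 * P.obsDist Q v φ := by
        rw [norm_sub_rev]; exact hdiff a
      have hbound (A B : ℤˣ → H) (hB : ∑ a, ‖B a‖ ^ 2 = ‖φ‖ ^ 2)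
          (hAB : ∀ a, ‖A a - B a‖ ^ 2 ≤ 1 / 4 * P.obsDist Q v φ) :
          ∑ a, (P.weight x (next a) (A a) - P.weight x (next a) (B a)) ≤
            t * ‖φ‖ ^ 2 + (1 + 1 / t) / 2 * P.obsDist Q v φ := by
        calc _ ≤ ∑ a, (t * ‖B a‖ ^ 2 + (1 + 1 / t) * (1 / 4 * P.obsDist Q v φ)) := by
              refine Finset.sum_le_sum fun a _ => (P.weight_sub_le x _ _ _ ht).trans ?_
              gcongr
              · exact P.weight_le x _ _
              · exact hAB a
          _ = _ := by
              rw [Finset.sum_add_distrib, ← Finset.mul_sum, hB, sum_intUnits]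
              ring
      rw [abs_le']
      refine ⟨hbound _ _ (Q.sum_norm_proj_sq v b φ) hdiff, ?_⟩
      rw [← Finset.sum_neg_distrib]
      simp only [neg_sub]
      exact hbound _ _ (P.sum_norm_proj_sq v b φ) hdiff'
    · exact (Finset.abs_sum_le_sum_abs _ _).trans
        (Finset.sum_le_sum fun a _ => (ih a _ (hnext a) _).trans_eq (by congr!))

end Hybrid

end Provers

/-! ### Products of local operators, one factor per prover. -/

/-- Noncommutative polynomials in the observables of one prover. -/
abbrev Poly : Type := FreeAlgebra ℂ Query

/-- The variable of `Poly` that stands for the observable of a query. -/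
abbrev qvar (b : Query) : Poly := FreeAlgebra.ι ℂ b

/-- The observable for an optional query; an ignored prover contributes `1`. -/
def queryPoly : Option Query → Poly
  | none => 1
  | some b => qvar b

namespace Provers

variable {V H : Type*} [NormedAddCommGroup H] [InnerProductSpace ℂ H] [CompleteSpace H]
  (P : Provers V H)

/-- Evaluation of a polynomial at the observables of prover `v`. -/
noncomputable def ev (v : V) : Poly →ₐ[ℂ] (H →L[ℂ] H) :=
  FreeAlgebra.lift ℂ (P.obs v)

@[simp]
theorem ev_qvar (v : V) (b : Query) : P.ev v (qvar b) = P.obs v b :=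
  FreeAlgebra.lift_ι_apply _ _

theorem ev_commute_of_obs {v : V} {A : H →L[ℂ] H} (h : ∀ b, Commute A (P.obs v b)) (f : Poly) :
    Commute A (P.ev v f) := by
  induction f using FreeAlgebra.induction with
  | grade0 r => rw [AlgHom.commutes]; exact Algebra.commute_algebraMap_right r A
  | grade1 b => rw [show FreeAlgebra.ι ℂ b = qvar b from rfl, ev_qvar]; exact h b
  | mul a b ha hb => rw [map_mul]; exact ha.mul_right hb
  | add a b ha hb => rw [map_add]; exact ha.add_right hb

theorem ev_commute {v w : V} (h : v ≠ w) (f g : Poly) : Commute (P.ev v f) (P.ev w g) :=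
  P.ev_commute_of_obs
    (fun b => (P.ev_commute_of_obs (fun c => P.obs_commute w v b c h.symm) f).symm) g

theorem pairwise_ev_commute : Pairwise fun v w => ∀ f g,
    Commute ((P.ev v : Poly →* (H →L[ℂ] H)) f) ((P.ev w : Poly →* (H →L[ℂ] H)) g) :=
  fun _ _ h f g => P.ev_commute h f g

theorem norm_ev_queryPoly (v : V) (b : Option Query) (φ : H) :
    ‖P.ev v (queryPoly b) φ‖ = ‖φ‖ := by
  cases b with
  | none => simp [queryPoly]
  | some b => rw [queryPoly, ev_qvar, norm_obs]

section Str

variable [Fintype V]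

/-- The product over all provers of local polynomials in their observables. -/
noncomputable def str : (V → Poly) →* (H →L[ℂ] H) :=
  MonoidHom.noncommPiCoprod (fun v => (P.ev v : Poly →* (H →L[ℂ] H)))
    P.pairwise_ev_commute

theorem str_eq_list_prod (f : V → Poly) :
    P.str f = (Finset.univ.toList.map fun v => P.ev v (f v)).prod := by
  classical
  rw [← Finset.noncommProd_toFinset _ _ (fun v _ w _ h => P.ev_commute h _ _)
    (Finset.nodup_toList _), str, MonoidHom.noncommPiCoprod_apply]
  exact Finset.noncommProd_congr (Finset.toList_toFinset _).symm (fun _ _ => rfl) _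

variable {P}

theorem str_congr {f g : V → Poly} (h : ∀ v, P.ev v (f v) = P.ev v (g v)) :
    P.str f = P.str g := by
  simp only [str_eq_list_prod, h]

variable (P)

theorem str_mulSingle [DecidableEq V] (v : V) (a : Poly) :
    P.str (Pi.mulSingle v a) = P.ev v a :=
  MonoidHom.noncommPiCoprod_mulSingle (fun v => (P.ev v : Poly →* (H →L[ℂ] H)))
    (hcomm := P.pairwise_ev_commute) v a

/-- The main tool for operator identities: they are checked separately in the algebra of each
prover, and a left factor at one prover comes out in front. -/
theorem str_eq_ev_mul {f g : V → Poly} (v : V) (a : Poly)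
    (hv : P.ev v (f v) = P.ev v (a * g v)) (h : ∀ w, w ≠ v → P.ev w (f w) = P.ev w (g w)) :
    P.str f = P.ev v a * P.str g := by
  classical
  rw [← str_mulSingle, ← map_mul]
  refine str_congr fun w => ?_
  by_cases hw : w = v
  · subst hw; simpa using hv
  · simp [Pi.mulSingle_eq_of_ne hw, h w hw]

theorem str_commute_ev {v : V} {f : V → Poly} (hf : f v = 1) (a : Poly) :
    Commute (P.str f) (P.ev v a) := by
  classical
  rw [← str_mulSingle]
  refine Commute.map ?_ P.str
  rw [commute_iff_eq]
  ext w : 1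
  by_cases hw : w = v
  · subst hw; simp [hf]
  · simp [Pi.mulSingle_eq_of_ne hw]

theorem norm_str_apply {f : V → Poly} (hf : ∀ v φ, ‖P.ev v (f v) φ‖ = ‖φ‖) (φ : H) :
    ‖P.str f φ‖ = ‖φ‖ := by
  rw [str_eq_list_prod]
  induction Finset.univ.toList (α := V) with
  | nil => simp
  | cons v l ih => simp [hf, ih]

theorem norm_str_queryPoly (q : V → Option Query) (φ : H) :
    ‖P.str (fun v => queryPoly (q v)) φ‖ = ‖φ‖ :=
  P.norm_str_apply (fun v φ => P.norm_ev_queryPoly v _ φ) φ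

theorem str_intertwine {H' : Type*} [NormedAddCommGroup H'] [InnerProductSpace ℂ H']
    [CompleteSpace H'] (Q : Provers V H') (J : H → H') {f : V → Poly}
    (hf : ∀ v φ, J (P.ev v (f v) φ) = Q.ev v (f v) (J φ)) (φ : H) :
    J (P.str f φ) = Q.str f (J φ) := by
  rw [str_eq_list_prod, str_eq_list_prod]
  induction Finset.univ.toList (α := V) with
  | nil => simp
  | cons v l ih => simp [hf, ih]

/-- `J` need not be linear; it will be evaluation at a bit string or a product of spectral
projections, under which `Z` becomes a sign. -/
theorem str_intertwine_smul {E : Type*} [AddCommGroup E] [Module ℂ E] (J : H → E) {f : V → Poly}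
    {s : V → ℂ} (hf : ∀ v φ, J (P.ev v (f v) φ) = s v • J φ) (φ : H) :
    J (P.str f φ) = (∏ v, s v) • J φ := by
  rw [str_eq_list_prod, ← Finset.prod_map_toList]
  induction Finset.univ.toList (α := V) with
  | nil => simp
  | cons v l ih => simp [hf, ih, smul_smul]

end Str

/-- The projections `(1 + aM) / 2`, weighted by the reply `a`, sum to `M`. As `M` commutes with the
rest of the string, each query contributes its observable as a factor. -/
theorem weight_productPattern (q : V → Option Query) (l : List V) (hl : l.Nodup) (s s₀ : ℤˣ)
    (φ : H) : P.weight s (productPattern q l s₀) φ =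
      (‖φ‖ ^ 2 + ((s * s₀ : ℤˣ) : ℤ) *
        (inner ℂ φ ((l.map fun v => P.ev v (queryPoly (q v))).prod φ)).re) / 2 := by
  induction l generalizing s₀ φ with
  | nil =>
    have h : (inner ℂ φ φ).re = ‖φ‖ ^ 2 := inner_self_eq_norm_sq (𝕜 := ℂ) φ
    rw [productPattern, weight, List.map_nil, List.prod_nil, one_apply_eq_self, h]
    rcases Int.units_eq_one_or s with rfl | rfl <;>
    rcases Int.units_eq_one_or s₀ with rfl | rfl <;> simp [show (1 : ℤˣ) ≠ -1 from by decide,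
      show (-1 : ℤˣ) ≠ 1 from by decide]
  | cons v l ih =>
    obtain ⟨hv, hl⟩ := List.nodup_cons.mp hl
    rw [List.map_cons, List.prod_cons]
    set O := (l.map fun v => P.ev v (queryPoly (q v))).prod with hO
    rw [productPattern]
    cases hq : q v with
    | none => simp only [ih hl]; simp [queryPoly]
    | some b =>
      have hcomm : Commute O (P.obs v b) := by
        rw [hO, ← ev_qvar]
        refine (Commute.list_prod_right _ _ ?_).symm
        intro A hA
        obtain ⟨w, hw, rfl⟩ := List.mem_map.mp hA
        exact P.ev_commute (by rintro rfl; exact hv hw) _ _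
      have hcross : (inner ℂ (P.obs v b φ) (O φ)).re =
          (inner ℂ φ (O (P.obs v b φ))).re := by
        rw [inner_obs]
        exact congrArg (fun A : H →L[ℂ] H => (inner ℂ φ (A φ)).re) hcomm.eq.symm
      have hdiag : (inner ℂ (P.obs v b φ) (O (P.obs v b φ))).re = (inner ℂ φ (O φ)).re := by
        rw [inner_obs]
        have := congrArg (fun A : H →L[ℂ] H => P.obs v b (A φ)) hcomm.eq
        simp only [mul_apply_eq_comp, obs_obs] at this
        rw [this]
      simp only [weight, ih hl]
      rw [sum_intUnits]
      simp only [norm_proj_sq]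
      simp only [proj_apply, queryPoly, ev_qvar, mul_apply_eq_comp]
      have hb : (inner ℂ φ (P.obs v b (O φ))).re = (inner ℂ φ (O (P.obs v b φ))).re := by
        rw [← inner_obs, hcross]
      rw [hb]
      simp only [map_smul, map_add, inner_smul_left, inner_smul_right, inner_add_left,
        inner_add_right]
      rcases Int.units_eq_one_or s with rfl | rfl <;>
      rcases Int.units_eq_one_or s₀ with rfl | rfl <;>
      · simp [hcross, hdiag]
        ring

theorem productProb_eq [Fintype V] (q : V → Option Query) (s : ℤˣ) :
    productProb P q s =
      (1 + (s : ℤ) * (inner ℂ P.state (P.str (fun v => queryPoly (q v)) P.state)).re) / 2 := by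
  rw [productProb, outcomeProb, P.weight_productPattern _ _ (Finset.nodup_toList _),
    str_eq_list_prod, P.norm_state]
  simp

end Provers

/-! ### Strings of the subtests and the triangle identity. -/

namespace Provers

variable {V : Type*} [Fintype V] {H : Type*} [NormedAddCommGroup H] [InnerProductSpace ℂ H] [CompleteSpace H]
  (P : Provers V H)

/-- The product of the observables for non-adaptive queries `q`. -/
noncomputable def qstr (q : V → Option Query) : H →L[ℂ] H := P.str fun v => queryPoly (q v)

theorem norm_qstr (q : V → Option Query) (φ : H) : ‖P.qstr q φ‖ = ‖φ‖ := P.norm_str_queryPoly q φ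

theorem norm_qstr_sub (q : V → Option Query) (φ χ : H) :
    ‖P.qstr q φ - P.qstr q χ‖ = ‖φ - χ‖ := by rw [← map_sub, norm_qstr]

theorem qstr_eq_obs_mul {q r : V → Option Query} (v : V) (b : Query) (hq : q v = some b)
    (hr : r v = none) (h : ∀ w, w ≠ v → q w = r w) : P.qstr q = P.obs v b * P.qstr r := by
  rw [← ev_qvar]
  exact P.str_eq_ev_mul v _ (by simp [hq, hr, queryPoly]) fun w hw => by rw [h w hw]

theorem qstr_commute_obs {q : V → Option Query} {v : V} (hq : q v = none) (b : Query) :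
    Commute (P.qstr q) (P.obs v b) := by
  rw [← ev_qvar]
  exact P.str_commute_ev (by simp [hq, queryPoly]) _

end Provers

variable {V : Type*} [DecidableEq V] (G : SimpleGraph V) [DecidableRel G.Adj]

/-- `Z` on the neighbours of `v`. -/
def nbrQuery (v : V) : V → Option Query := fun w => if G.Adj v w then some .Z else none

/-- `X` on `u`, and `Z` on the neighbours of `u`, with `v` left out. -/
def sideQuery (v u : V) : V → Option Query := fun w =>
  if w = v then none else if w = u then some .X else if G.Adj u w then some .Z else none

namespace Provers

variable [Fintype V] {H : Type*} [NormedAddCommGroup H] [InnerProductSpace ℂ H] [CompleteSpace H]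
  (P : Provers V H)

theorem qstr_vertexQuery (v : V) :
    P.qstr (vertexQuery G v) = P.obs v .X * P.qstr (nbrQuery G v) :=
  P.qstr_eq_obs_mul v _ (by simp [vertexQuery]) (by simp [nbrQuery]) fun w hw => by
    simp [vertexQuery, nbrQuery, hw]

theorem qstr_rXQuery (v : V) (t : ℤˣ) :
    P.qstr (rXQuery G v t) = P.obs v (.R t) * P.qstr (nbrQuery G v) :=
  P.qstr_eq_obs_mul v _ (by simp [rXQuery]) (by simp [nbrQuery]) fun w hw => by
    simp [rXQuery, nbrQuery, hw]

theorem qstr_rZQuery (v u : V) (t : ℤˣ) :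
    P.qstr (rZQuery G v u t) = P.obs v (.R t) * P.qstr (sideQuery G v u) :=
  P.qstr_eq_obs_mul v _ (by simp [rZQuery]) (by simp [sideQuery]) fun w hw => by
    simp [rZQuery, sideQuery, hw]

variable {G}

/-- The stabiliser of `u` contains `Z` at its neighbour `v`, so on a stabilised state the remaining
factors act like `Z` of `v`. -/
theorem qstr_vertexQuery_of_adj {v u : V} (h : G.Adj v u) :
    P.qstr (vertexQuery G u) = P.obs v .Z * P.qstr (sideQuery G v u) :=
  P.qstr_eq_obs_mul v _ (by simp [vertexQuery, h.ne, h.symm]) (by simp [sideQuery]) fun w hw => by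
    simp [vertexQuery, sideQuery, hw]

/-- The stabilisers of the vertices of a triangle multiply to the triangle operator, up to a
group commutator of the observables of the middle vertex. -/
theorem qstr_triangle {a b c : V} (hab : G.Adj a b) (hac : G.Adj a c) (hbc : G.Adj b c) :
    P.qstr (vertexQuery G a) * P.qstr (vertexQuery G b) * P.qstr (vertexQuery G c) =
      P.obs b .Z * P.obs b .X * P.obs b .Z * P.obs b .X *
        P.qstr (triangleQuery G {a, b, c}) := by
  have hev : P.obs b .Z * P.obs b .X * P.obs b .Z * P.obs b .X =
      P.ev b (qvar .Z * qvar .X * qvar .Z * qvar .X) := by simp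
  rw [hev]
  simp only [qstr, ← map_mul]
  have hne := hab.ne; have hne' := hac.ne; have hne'' := hbc.ne
  -- At `b` the factors are `Z X Z = (Z X Z X) X`. At `a` and `c` the two `Z` are adjacent and
  -- cancel; elsewhere only the parity of the number of `Z` matters.
  refine P.str_eq_ev_mul b _ ?_ fun w hw => ?_
  · simp [vertexQuery, triangleQuery, hne.symm, hne'', hab, hbc.symm, queryPoly, mul_assoc,
      obs_sq]
  · by_cases hwa : w = a
    · subst hwa
      simp [vertexQuery, triangleQuery, hne, hne', hab.symm, hac.symm, queryPoly, mul_assoc,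
        obs_sq]
    by_cases hwc : w = c
    · subst hwc
      simp [vertexQuery, triangleQuery, hwa, hw, hac, hbc, queryPoly, obs_sq]
    have hsq : P.obs w .Z * P.obs w .Z = 1 := P.obs_sq _ _
    simp only [vertexQuery, triangleQuery, Pi.mul_apply, map_mul, hw, hwa, hwc, if_false,
      Finset.mem_insert, Finset.mem_singleton, or_self, Finset.filter_insert,
      Finset.filter_singleton, G.adj_comm w]
    by_cases h1 : G.Adj a w <;> by_cases h2 : G.Adj b w <;> by_cases h3 : G.Adj c w <;>
      simp [h1, h2, h3, hne, hne', hne'', queryPoly, hsq, show Odd 3 from by decide,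
        show ¬ Odd 2 from by decide]

end Provers

/-! ### The deficit as a sum of squares, and approximate anticommutation. -/

namespace Provers

variable {V : Type*} [Fintype V] {H : Type*} [NormedAddCommGroup H] [InnerProductSpace ℂ H]
  [CompleteSpace H] (P : Provers V H)

theorem productProb_one (q : V → Option Query) :
    productProb P q 1 = 1 - ‖P.qstr q P.state - P.state‖ ^ 2 / 4 := by
  rw [productProb_eq, norm_sub_rev, @norm_sub_sq ℂ, norm_qstr, P.norm_state]
  change _ = 1 - (1 ^ 2 - 2 * (inner ℂ P.state (P.qstr q P.state)).re + 1 ^ 2) / 4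
  rw [qstr]
  push_cast
  ring

theorem productProb_neg_one (q : V → Option Query) :
    productProb P q (-1) = 1 - ‖P.qstr q P.state + P.state‖ ^ 2 / 4 := by
  rw [productProb_eq, add_comm (P.qstr q P.state), @norm_add_sq ℂ, norm_qstr, P.norm_state]
  change _ = 1 - (1 ^ 2 + 2 * (inner ℂ P.state (P.qstr q P.state)).re + 1 ^ 2) / 4
  rw [qstr]
  push_cast
  ring

omit [CompleteSpace H] in
/-- For real coefficients with `c ^ 2 + s ^ 2 = 1` the cross terms of the two signs cancel. -/
theorem sum_norm_sub_sq {c s : ℝ} (h : c ^ 2 + s ^ 2 = 1) (x : ℤˣ → H) (y z : H)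
    (hx : ∀ t, ‖x t‖ = 1) (hy : ‖y‖ = 1) (hz : ‖z‖ = 1) :
    ∑ t, ‖x t - ((c : ℂ) • y + (((t : ℤ) * s : ℝ) : ℂ) • z)‖ ^ 2 =
      4 - 2 * ∑ t, (c * (inner ℂ (x t) y).re + (t : ℤ) * s * (inner ℂ (x t) z).re) := by
  rw [sum_intUnits, sum_intUnits]
  simp only [@norm_sub_sq ℂ, @norm_add_sq ℂ, norm_smul, hx, hy, hz, inner_add_right,
    inner_smul_right, inner_smul_left, mul_pow]
  simp only [RCLike.re_to_complex, Complex.conj_ofReal, Complex.re_ofReal_mul, Complex.add_re,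
    Complex.norm_real, Real.norm_eq_abs, sq_abs]
  push_cast
  linear_combination 2 * h

variable [DecidableEq V] (G : SimpleGraph V) [DecidableRel G.Adj]

/-- Squared error of the stabiliser condition of a vertex. -/
noncomputable def stabErr (v : V) : ℝ := ‖P.qstr (vertexQuery G v) P.state - P.state‖ ^ 2

/-- Squared error of the triangle condition. -/
noncomputable def triangleErr (τ : Finset V) : ℝ :=
  ‖P.qstr (triangleQuery G τ) P.state + P.state‖ ^ 2

/-- Squared error of the observables `R(±θ v)`, compared with their expansion in `X` and `Z`, which
are represented by stabiliser-equivalent observables of other provers. -/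
noncomputable def rotErr (nb : V → V) (θ : V → ℝ) (v : V) : ℝ :=
  ∑ t : ℤˣ, ‖P.obs v (.R t) P.state -
    (((Real.cos (θ v) : ℝ) : ℂ) • P.qstr (nbrQuery G v) P.state +
      (((t : ℤ) * |Real.sin (θ v)| : ℝ) : ℂ) • P.qstr (sideQuery G v (nb v)) P.state)‖ ^ 2

theorem rotErr_nonneg (nb : V → V) (θ : V → ℝ) (v : V) : 0 ≤ P.rotErr G nb θ v := by
  unfold rotErr; positivity

/-- The weights `cos : |sin|` make acceptance an inner product of `R(tθ)ψ` with a combination of the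
two string vectors; completing the square gives `rotErr`. Averaging over both signs of the angle
removes the overlap of these vectors, so they need not be orthogonal. -/
theorem sum_productProb_rot (nb : V → V) (θ : V → ℝ) (v : V)
    (hcs : 0 < Real.cos (θ v) + |Real.sin (θ v)|) :
    ∑ t : ℤˣ, (Real.cos (θ v) / (Real.cos (θ v) + |Real.sin (θ v)|) *
        productProb P (rXQuery G v t) 1 +
      |Real.sin (θ v)| / (Real.cos (θ v) + |Real.sin (θ v)|) *
        productProb P (rZQuery G v (nb v) t) t) =
      1 + 1 / (Real.cos (θ v) + |Real.sin (θ v)|) -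
        P.rotErr G nb θ v / (4 * (Real.cos (θ v) + |Real.sin (θ v)|)) := by
  have hsq : Real.cos (θ v) ^ 2 + |Real.sin (θ v)| ^ 2 = 1 := by
    rw [sq_abs, Real.cos_sq_add_sin_sq]
  have hX (t : ℤˣ) : productProb P (rXQuery G v t) 1 =
      (1 + (inner ℂ (P.obs v (.R t) P.state) (P.qstr (nbrQuery G v) P.state)).re) / 2 := by
    rw [productProb_eq, ← qstr, qstr_rXQuery, mul_apply_eq_comp, ← inner_obs]
    simp
  have hZ (t : ℤˣ) : productProb P (rZQuery G v (nb v) t) t =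
      (1 + (t : ℤ) *
        (inner ℂ (P.obs v (.R t) P.state) (P.qstr (sideQuery G v (nb v)) P.state)).re) / 2 := by
    rw [productProb_eq, ← qstr, qstr_rZQuery, mul_apply_eq_comp, ← inner_obs]
  rw [rotErr, sum_norm_sub_sq hsq _ _ _ (fun t => by rw [norm_obs, P.norm_state])
    (by rw [norm_qstr, P.norm_state]) (by rw [norm_qstr, P.norm_state])]
  simp only [hX, hZ, sum_intUnits]
  push_cast
  field_simp
  ring

omit [DecidableEq V] in
theorem numSubtests_pos [Nonempty V] (T : Finset (Finset V)) : 0 < (numSubtests T : ℝ) := by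
  have : 0 < Fintype.card V := Fintype.card_pos
  exact_mod_cast (by unfold numSubtests; omega : 0 < numSubtests T)

/-- The deficit of the acceptance probability is a sum of squared errors. -/
theorem deficit_eq [Nonempty V] (T : Finset (Finset V)) (nb : V → V) (θ : V → ℝ)
    (hθ : ∀ v, 0 < Real.cos (θ v) + |Real.sin (θ v)|) :
    numSubtests T * (cTest T θ - acceptProb G T nb θ P) =
      ∑ v, P.stabErr G v / 4 + ∑ τ ∈ T, P.triangleErr G τ / 4 +
        ∑ v, P.rotErr G nb θ v / (4 * (Real.cos (θ v) + |Real.sin (θ v)|)) := by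
  have hN := numSubtests_pos (V := V) T
  have hn : (Fintype.card V : ℝ) ≠ 0 := by exact_mod_cast Fintype.card_ne_zero
  have hT : (T.card : ℝ) * ∑ τ ∈ T, 1 / (T.card : ℝ) * productProb P (triangleQuery G τ) (-1) =
      ∑ τ ∈ T, productProb P (triangleQuery G τ) (-1) := by
    rcases T.eq_empty_or_nonempty with rfl | h
    · simp
    · have : (T.card : ℝ) ≠ 0 := by exact_mod_cast h.card_pos.ne'
      rw [← Finset.mul_sum]
      field_simp
  have hR : (Fintype.card V : ℝ) * ∑ t : ℤˣ, ∑ v, 1 / (Fintype.card V : ℝ) *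
      (Real.cos (θ v) / (Real.cos (θ v) + |Real.sin (θ v)|) * productProb P (rXQuery G v t) 1 +
       |Real.sin (θ v)| / (Real.cos (θ v) + |Real.sin (θ v)|) *
      productProb P (rZQuery G v (nb v) t) t) =
      ∑ v, (1 + 1 / (Real.cos (θ v) + |Real.sin (θ v)|) -
        P.rotErr G nb θ v / (4 * (Real.cos (θ v) + |Real.sin (θ v)|))) := by
    rw [Finset.sum_comm]
    simp only [← Finset.mul_sum, P.sum_productProb_rot G nb θ _ (hθ _)]
    rw [← mul_assoc, mul_one_div_cancel hn, one_mul]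
  have hS : (Fintype.card V : ℝ) * ∑ v, 1 / (Fintype.card V : ℝ) *
      productProb P (vertexQuery G v) 1 = ∑ v, productProb P (vertexQuery G v) 1 := by
    rw [← Finset.mul_sum]
    field_simp
  have hacc : numSubtests T * acceptProb G T nb θ P =
      ∑ v, productProb P (vertexQuery G v) 1 +
      ∑ τ ∈ T, productProb P (triangleQuery G τ) (-1) +
      ∑ v, (1 + 1 / (Real.cos (θ v) + |Real.sin (θ v)|) -
        P.rotErr G nb θ v / (4 * (Real.cos (θ v) + |Real.sin (θ v)|))) := by
    rw [← hS, ← hT, ← hR, acceptProb]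
    rw [← Finset.mul_sum Finset.univ _ (1 / 2 : ℝ)]
    have key (a b e n m N : ℝ) (hN : N ≠ 0) :
        N * (n / N * a + m / N * b + 2 * n / N * (1 / 2 * e)) = n * a + m * b + n * e := by
      field_simp
    exact key _ _ _ _ _ _ hN.ne'
  rw [mul_sub, hacc, cTest, mul_div_cancel₀ _ hN.ne']
  simp only [productProb_one, productProb_neg_one, stabErr, triangleErr, Finset.sum_sub_distrib,
    Finset.sum_add_distrib, Finset.sum_const, Finset.card_univ, nsmul_eq_mul, mul_one]
  ring

/-- Given bounds for the stabiliser and triangle errors, the observables `X` and `Z` of a vertex in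
a triangle nearly anticommute on the state. -/
theorem norm_anticommutator_le {d : ℝ} (hs : ∀ v, ‖P.qstr (vertexQuery G v) P.state - P.state‖ ≤ d)
    {τ : Finset V} (hτ : G.IsNClique 3 τ) {b : V} (hb : b ∈ τ)
    (ht : ‖P.qstr (triangleQuery G τ) P.state + P.state‖ ≤ d) :
    ‖P.obs b .X (P.obs b .Z P.state) + P.obs b .Z (P.obs b .X P.state)‖ ≤ 4 * d := by
  obtain ⟨a, c, hab, hac, hbc, rfl⟩ : ∃ a c, G.Adj a b ∧ G.Adj a c ∧ G.Adj b c ∧ τ = {a, b, c} := by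
    obtain ⟨x, y, z, hxy, hxz, hyz, rfl⟩ := SimpleGraph.is3Clique_iff.mp hτ
    simp only [Finset.mem_insert, Finset.mem_singleton] at hb
    rcases hb with rfl | rfl | rfl
    · exact ⟨y, z, hxy.symm, hyz, hxz, by ext; simp; tauto⟩
    · exact ⟨x, z, hxy, hxz, hyz, rfl⟩
    · exact ⟨x, y, hxz, hxy, hyz.symm, by ext; simp; tauto⟩
  set ψ := P.state with hψ
  set Y := P.obs b .Z * P.obs b .X * P.obs b .Z * P.obs b .X with hY
  have hYn (φ : H) : ‖Y φ‖ = ‖φ‖ := by simp [hY, mul_apply_eq_comp, norm_obs]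
  have h := congrArg (fun A : H →L[ℂ] H => A ψ) (P.qstr_triangle hab hac hbc)
  simp only [mul_apply_eq_comp] at h
  set Sa := P.qstr (vertexQuery G a)
  set Sb := P.qstr (vertexQuery G b)
  set Sc := P.qstr (vertexQuery G c)
  set St := P.qstr (triangleQuery G {a, b, c})
  have h' : Sa (Sb (Sc ψ)) = Y (St ψ) := by simpa [hY, mul_apply_eq_comp] using h
  -- With `Y = ZXZX` one has `XZY = ZX`, so the anticommutator is `XZ(Y + 1)`.
  have hab' : P.obs b .X (P.obs b .Z ψ) + P.obs b .Z (P.obs b .X ψ) =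
      P.obs b .X (P.obs b .Z (Y ψ + ψ)) := by
    simp [hY, mul_apply_eq_comp, obs_obs, add_comm]
  have e1 : ‖Sa (Sb (Sc ψ)) - Sa (Sb ψ)‖ ≤ d := by
    rw [norm_qstr_sub, norm_qstr_sub]; exact hs c
  have e2 : ‖Sa (Sb ψ) - Sa ψ‖ ≤ d := by rw [norm_qstr_sub]; exact hs b
  have e3 : ‖Sa ψ - ψ‖ ≤ d := hs a
  have e4 : ‖Y (St ψ) + Y ψ‖ ≤ d := by rw [← map_add, hYn]; exact ht
  -- The common vector `Sa Sb Sc ψ = Y St ψ` is within `3d` of `ψ` and within `d` of `-Y ψ`.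
  have heq : Y ψ + ψ = (Y (St ψ) + Y ψ) - (Sa (Sb (Sc ψ)) - Sa (Sb ψ)) - (Sa (Sb ψ) - Sa ψ) -
      (Sa ψ - ψ) := by
    rw [h']; abel
  rw [hab', norm_obs, norm_obs, heq]
  refine (norm_sub_le _ _).trans ?_
  have := norm_sub_le ((Y (St ψ) + Y ψ) - (Sa (Sb (Sc ψ)) - Sa (Sb ψ))) (Sa (Sb ψ) - Sa ψ)
  have := norm_sub_le (Y (St ψ) + Y ψ) (Sa (Sb (Sc ψ)) - Sa (Sb ψ))
  linarith

variable {G}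

theorem norm_nbr_sub (v : V) : ‖P.qstr (nbrQuery G v) P.state - P.obs v .X P.state‖ =
    ‖P.qstr (vertexQuery G v) P.state - P.state‖ := by
  rw [qstr_vertexQuery, mul_apply_eq_comp, ← P.norm_obs v .X, map_sub, obs_obs]

theorem norm_side_sub {v u : V} (h : G.Adj v u) :
    ‖P.qstr (sideQuery G v u) P.state - P.obs v .Z P.state‖ =
      ‖P.qstr (vertexQuery G u) P.state - P.state‖ := by
  rw [qstr_vertexQuery_of_adj P h, mul_apply_eq_comp, ← P.norm_obs v .Z, map_sub, obs_obs]

end Provers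

/-! ### Bit flips and signs. -/

section Flip

variable {V : Type*} [DecidableEq V]

/-- Flip the bit at `v`. -/
def flipBit (x : V → Fin 2) (v : V) : V → Fin 2 := Function.update x v (x v + 1)

@[simp]
theorem flipBit_self (x : V → Fin 2) (v : V) : flipBit x v v = x v + 1 := by simp [flipBit]

theorem flipBit_of_ne (x : V → Fin 2) {v w : V} (h : w ≠ v) : flipBit x v w = x w := by
  simp [flipBit, h]

theorem fin_two_add_one_add_one (a : Fin 2) : a + 1 + 1 = a := by fin_cases a <;> rfl

@[simp]
theorem flipBit_flipBit (x : V → Fin 2) (v : V) : flipBit (flipBit x v) v = x := by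
  ext w : 1
  by_cases h : w = v
  · subst h; simp [fin_two_add_one_add_one]
  · simp [flipBit_of_ne _ h]

theorem flipBit_comm (x : V → Fin 2) {v w : V} (h : v ≠ w) :
    flipBit (flipBit x v) w = flipBit (flipBit x w) v := by
  simp only [flipBit, Function.update_of_ne h, Function.update_of_ne h.symm]
  exact Function.update_comm h _ _ _

theorem flipBit_ne (x : V → Fin 2) (v : V) : flipBit x v ≠ x := fun h => by
  have := congrFun h v
  rw [flipBit_self] at this
  revert this
  generalize x v = a
  fin_cases a <;> decide

/-- Flipping a bit, as a permutation of the bit strings. -/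
def flipEquiv (v : V) : (V → Fin 2) ≃ (V → Fin 2) where
  toFun x := flipBit x v
  invFun x := flipBit x v
  left_inv x := flipBit_flipBit x v
  right_inv x := flipBit_flipBit x v

/-- The sign `(-1) ^ b` of a bit. -/
def bitSign (b : Fin 2) : ℂ := (-1) ^ (b : ℕ)

@[simp]
theorem bitSign_add_one (b : Fin 2) : bitSign (b + 1) = -bitSign b := by
  fin_cases b <;> simp [bitSign]

@[simp]
theorem bitSign_mul_self (b : Fin 2) : bitSign b * bitSign b = 1 := by
  fin_cases b <;> simp [bitSign]

@[simp]
theorem bitSign_zero : bitSign 0 = 1 := rfl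

@[simp]
theorem star_bitSign (b : Fin 2) : (starRingEnd ℂ) (bitSign b) = bitSign b := by
  fin_cases b <;> simp [bitSign]

end Flip

/-! ### Provers with exact Pauli relations. -/

section Pauli

variable {V H : Type*} [NormedAddCommGroup H] [InnerProductSpace ℂ H] [CompleteSpace H]

/-- The observables of each prover satisfy the relations of the ideal one-qubit observables. -/
structure Provers.IsPauli (P : Provers V H) (θ : V → ℝ) : Prop where
  anticomm : ∀ v φ, P.obs v .X (P.obs v .Z φ) = -P.obs v .Z (P.obs v .X φ)
  rot : ∀ v t, P.obs v (.R t) = (Real.cos ((t : ℤ) * θ v) : ℂ) • P.obs v .X +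
    (Real.sin ((t : ℤ) * θ v) : ℂ) • P.obs v .Z

/-- Provers whose `R(±θ)` are defined by anticommuting observables `X` and `Z`. -/
noncomputable def pauliProvers (ψ : H) (hψ : ‖ψ‖ = 1) (A B : V → H →L[ℂ] H) (θ : V → ℝ)
    (hA : ∀ v, IsSelfAdjoint (A v)) (hB : ∀ v, IsSelfAdjoint (B v))
    (hA2 : ∀ v, A v * A v = 1) (hB2 : ∀ v, B v * B v = 1)
    (hAB : ∀ v, A v * B v = -(B v * A v)) (hAA : ∀ v w, v ≠ w → Commute (A v) (A w))
    (hBB : ∀ v w, v ≠ w → Commute (B v) (B w)) (hAB' : ∀ v w, v ≠ w → Commute (A v) (B w)) :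
    Provers V H where
  state := ψ
  norm_state := hψ
  obs v
    | .X => A v
    | .Z => B v
    | .R t => (Real.cos ((t : ℤ) * θ v) : ℂ) • A v + (Real.sin ((t : ℤ) * θ v) : ℂ) • B v
  obs_selfAdjoint v b := by
    cases b with
    | X => exact hA v
    | Z => exact hB v
    | R t =>
      refine IsSelfAdjoint.add ?_ ?_
      · exact IsSelfAdjoint.smul (Complex.conj_ofReal _) (hA v)
      · exact IsSelfAdjoint.smul (Complex.conj_ofReal _) (hB v)
  obs_sq v b := by
    cases b with
    | X => exact hA2 v
    | Z => exact hB2 v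
    | R t =>
      have h : (Real.cos ((t : ℤ) * θ v) : ℂ) * Real.cos ((t : ℤ) * θ v) +
          (Real.sin ((t : ℤ) * θ v) : ℂ) * Real.sin ((t : ℤ) * θ v) = 1 := by
        rw [← Complex.ofReal_mul, ← Complex.ofReal_mul, ← Complex.ofReal_add, ← sq, ← sq,
          Real.cos_sq_add_sin_sq, Complex.ofReal_one]
      simp only [add_mul, mul_add, smul_mul_smul_comm, hA2, hB2, hAB]
      refine Eq.trans ?_ ((congrArg (· • (1 : H →L[ℂ] H)) h).trans (one_smul ℂ _))
      generalize (Real.cos ((t : ℤ) * θ v) : ℂ) = c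
      generalize (Real.sin ((t : ℤ) * θ v) : ℂ) = s
      module
  obs_commute v w b c h := by
    have hX : ∀ c, Commute (A v) (match c with
        | Query.X => A w
        | .Z => B w
        | .R t => (Real.cos ((t : ℤ) * θ w) : ℂ) • A w +
            (Real.sin ((t : ℤ) * θ w) : ℂ) • B w) := fun c => by
      cases c with
      | X => exact hAA v w h
      | Z => exact hAB' v w h
      | R t => exact ((hAA v w h).smul_right _).add_right ((hAB' v w h).smul_right _)
    have hZ : ∀ c, Commute (B v) (match c with
        | Query.X => A w
        | .Z => B w
        | .R t => (Real.cos ((t : ℤ) * θ w) : ℂ) • A w +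
            (Real.sin ((t : ℤ) * θ w) : ℂ) • B w) := fun c => by
      cases c with
      | X => exact (hAB' w v h.symm).symm
      | Z => exact hBB v w h
      | R t => exact ((hAB' w v h.symm).symm.smul_right _).add_right ((hBB v w h).smul_right _)
    cases b with
    | X => exact hX c
    | Z => exact hZ c
    | R t => exact ((hX c).smul_left _).add_left ((hZ c).smul_left _)

end Pauli

/-! ### Exact anticommutation with one ancilla qubit per prover. -/

section Extension

variable {V : Type*} [Fintype V] {H : Type*} [NormedAddCommGroup H]
  [InnerProductSpace ℂ H] [CompleteSpace H]

/-- The tensor product of `H` with one additional qubit for each prover. -/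
abbrev Ext (V H : Type*) [Fintype V] [NormedAddCommGroup H] [InnerProductSpace ℂ H] : Type _ :=
  PiLp 2 fun _ : V → Fin 2 => H

/-- The coordinate at a bit string. -/
noncomputable def Ext.coord (x : V → Fin 2) : Ext V H →L[ℂ] H := PiLp.proj 2 (fun _ => H) x

/-- An operator on the extended space, given by its rows. -/
noncomputable def Ext.ofRows (F : (V → Fin 2) → Ext V H →L[ℂ] H) : Ext V H →L[ℂ] Ext V H :=
  (PiLp.continuousLinearEquiv 2 ℂ fun _ : V → Fin 2 => H).symm.toContinuousLinearMap ∘L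
    ContinuousLinearMap.pi F

omit [CompleteSpace H] in
@[simp]
theorem Ext.ofRows_apply (F : (V → Fin 2) → Ext V H →L[ℂ] H) (f : Ext V H) (x : V → Fin 2) :
    Ext.ofRows F f x = F x f := rfl

omit [CompleteSpace H] in
@[simp]
theorem Ext.coord_apply (x : V → Fin 2) (f : Ext V H) : Ext.coord x f = f x := rfl

/-- An operator on `H`, acting on the extended space. -/
noncomputable def Ext.lift (A : H →L[ℂ] H) : Ext V H →L[ℂ] Ext V H :=
  Ext.ofRows fun x => A ∘L Ext.coord x

omit [CompleteSpace H] in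
@[simp]
theorem Ext.lift_apply (A : H →L[ℂ] H) (f : Ext V H) (x : V → Fin 2) :
    Ext.lift A f x = A (f x) := rfl

/-- The embedding of `H` with the additional qubits in the state `|0⟩`. -/
noncomputable def Ext.incl (φ : H) : Ext V H := PiLp.single 2 0 φ

omit [CompleteSpace H] in
theorem Ext.norm_incl [DecidableEq V] (φ : H) : ‖(Ext.incl φ : Ext V H)‖ = ‖φ‖ := by
  rw [Ext.incl]; exact PiLp.norm_single 2 _ _ _

omit [CompleteSpace H] in
theorem Ext.incl_sub [DecidableEq V] (φ χ : H) : (Ext.incl (φ - χ) : Ext V H) = Ext.incl φ - Ext.incl χ := by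
  rw [Ext.incl, PiLp.single_sub]; rfl

variable (P : Provers V H)

namespace Provers

/-- The part of `X` that commutes with `Z`. -/
noncomputable def evenX (v : V) : H →L[ℂ] H :=
  (1 / 2 : ℂ) • (P.obs v .X + P.obs v .Z * P.obs v .X * P.obs v .Z)

/-- The part of `X` that anticommutes with `Z`. -/
noncomputable def oddX (v : V) : H →L[ℂ] H :=
  (1 / 2 : ℂ) • (P.obs v .X - P.obs v .Z * P.obs v .X * P.obs v .Z)

omit [Fintype V] in
theorem evenX_apply (v : V) (φ : H) : P.evenX v φ =
    (1 / 2 : ℂ) • (P.obs v .X φ + P.obs v .Z (P.obs v .X (P.obs v .Z φ))) := by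
  simp [evenX]

omit [Fintype V] in
theorem oddX_apply (v : V) (φ : H) : P.oddX v φ =
    (1 / 2 : ℂ) • (P.obs v .X φ - P.obs v .Z (P.obs v .X (P.obs v .Z φ))) := by
  simp [oddX]

omit [Fintype V] in
theorem evenX_commute {v : V} {A : H →L[ℂ] H} (h : ∀ b, Commute A (P.obs v b)) :
    Commute A (P.evenX v) :=
  ((h _).add_right (((h _).mul_right (h _)).mul_right (h _))).smul_right _

omit [Fintype V] in
theorem oddX_commute {v : V} {A : H →L[ℂ] H} (h : ∀ b, Commute A (P.obs v b)) :
    Commute A (P.oddX v) :=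
  ((h _).sub_right (((h _).mul_right (h _)).mul_right (h _))).smul_right _

omit [Fintype V] in
theorem inner_evenX (v : V) (φ χ : H) :
    inner ℂ (P.evenX v φ) χ = inner ℂ φ (P.evenX v χ) := by
  have h : (starRingEnd ℂ) (1 / 2) = 1 / 2 := Complex.conj_eq_iff_real.mpr ⟨1 / 2, by norm_num⟩
  simp only [evenX_apply, inner_smul_left, inner_smul_right, inner_add_left, inner_add_right,
    inner_obs, h]

omit [Fintype V] in
theorem inner_oddX (v : V) (φ χ : H) :
    inner ℂ (P.oddX v φ) χ = inner ℂ φ (P.oddX v χ) := by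
  have h : (starRingEnd ℂ) (1 / 2) = 1 / 2 := Complex.conj_eq_iff_real.mpr ⟨1 / 2, by norm_num⟩
  simp only [oddX_apply, inner_smul_left, inner_smul_right, inner_sub_left, inner_sub_right,
    inner_obs, h]

/-- The family of provers on the extended space that ignores the additional qubits. -/
noncomputable def lift [DecidableEq V] : Provers V (Ext V H) where
  state := Ext.incl P.state
  norm_state := by simp [Ext.incl, PiLp.norm_single, P.norm_state]
  obs v b := Ext.lift (P.obs v b)
  obs_selfAdjoint v b := by
    refine ContinuousLinearMap.isSelfAdjoint_iff_isSymmetric.mpr fun f g => ?_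
    simp [PiLp.inner_apply, inner_obs]
  obs_sq v b := by
    ext f x
    simp [obs_obs]
  obs_commute v w b c h := by
    rw [commute_iff_eq]
    ext f x
    simpa using congrArg (fun A : H →L[ℂ] H => A (f x)) (P.obs_commute v w b c h).eq

variable [DecidableEq V]

/-- The observable `X` corrected by means of the additional qubit. -/
noncomputable def extX (v : V) : Ext V H →L[ℂ] Ext V H :=
  Ext.ofRows fun x => P.evenX v ∘L Ext.coord (flipBit x v) + P.oddX v ∘L Ext.coord x

/-- The observable `Z` combined with that of the additional qubit. -/
noncomputable def extZ (v : V) : Ext V H →L[ℂ] Ext V H :=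
  Ext.ofRows fun x => bitSign (x v) • (P.obs v .Z ∘L Ext.coord x)

theorem extX_apply (v : V) (f : Ext V H) (x : V → Fin 2) :
    P.extX v f x = P.evenX v (f (flipBit x v)) + P.oddX v (f x) := rfl

omit [DecidableEq V] in
theorem extZ_apply (v : V) (f : Ext V H) (x : V → Fin 2) :
    P.extZ v f x = bitSign (x v) • P.obs v .Z (f x) := rfl

theorem Commute.extX {v : V} {A : H →L[ℂ] H} (h : ∀ b, Commute A (P.obs v b)) :
    Commute (Ext.lift A) (P.extX v) := by
  rw [commute_iff_eq]
  ext f x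
  have h1 (φ) := congrArg (fun B : H →L[ℂ] H => B φ) (P.evenX_commute h).eq
  have h2 (φ) := congrArg (fun B : H →L[ℂ] H => B φ) (P.oddX_commute h).eq
  simp only [mul_apply_eq_comp] at h1 h2
  simp [extX_apply, h1, h2]

omit [DecidableEq V] in
theorem Commute.extZ {v : V} {A : H →L[ℂ] H} (h : ∀ b, Commute A (P.obs v b)) :
    Commute (Ext.lift A) (P.extZ v) := by
  rw [commute_iff_eq]
  ext f x
  have h1 (φ) := congrArg (fun B : H →L[ℂ] H => B φ) (h .Z).eq
  simp only [mul_apply_eq_comp] at h1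
  simp [extZ_apply, h1]

/-- The exact Pauli observables on the extended space that approximate those of `P`. -/
noncomputable def ideal (θ : V → ℝ) : Provers V (Ext V H) :=
  pauliProvers (Ext.incl P.state) P.lift.norm_state P.extX P.extZ θ
    (fun v => by
      refine ContinuousLinearMap.isSelfAdjoint_iff_isSymmetric.mpr fun f g => ?_
      simp only [ContinuousLinearMap.coe_coe, PiLp.inner_apply, extX_apply, inner_add_left,
        inner_add_right, Finset.sum_add_distrib, inner_evenX, inner_oddX]
      congr 1
      refine Fintype.sum_equiv (flipEquiv v) _ _ fun x => ?_
      simp [flipEquiv])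
    (fun v => by
      refine ContinuousLinearMap.isSelfAdjoint_iff_isSymmetric.mpr fun f g => ?_
      simp [PiLp.inner_apply, extZ_apply, inner_smul_left, inner_smul_right, inner_obs])
    -- The squares of `E + O = X` and `E - O = ZXZ` are `1`, so `E² + O² = 1` and `EO + OE = 0`.
    (fun v => by
      ext f x
      simp only [mul_apply_eq_comp, extX_apply, map_add, flipBit_flipBit, evenX_apply, oddX_apply,
        map_sub, map_smul, obs_obs, one_apply_eq_self]
      module)
    (fun v => by
      ext f x
      simp [extZ_apply, obs_obs, smul_smul])
    -- The even part commutes with `Z` but flips the ancilla sign; the odd part anticommutes with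
    -- `Z` and leaves the ancilla alone.
    (fun v => by
      ext f x
      simp only [mul_apply_eq_comp, extX_apply, extZ_apply, neg_apply,
        PiLp.neg_apply, map_add, evenX_apply, oddX_apply, map_sub, map_smul, obs_obs,
        flipBit_self, bitSign_add_one]
      module)
    (fun v w h => by
      have h1 := fun b => P.evenX_commute (A := P.obs v b) (v := w) fun c => P.obs_commute v w b c h
      have h2 := fun b => P.oddX_commute (A := P.obs v b) (v := w) fun c => P.obs_commute v w b c h
      have h11 (φ) := congrArg (fun B : H →L[ℂ] H => B φ)
        (P.evenX_commute (fun b => (h1 b).symm)).eq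
      have h12 (φ) := congrArg (fun B : H →L[ℂ] H => B φ)
        (P.oddX_commute (fun b => (h1 b).symm)).eq
      have h21 (φ) := congrArg (fun B : H →L[ℂ] H => B φ)
        (P.evenX_commute (fun b => (h2 b).symm)).eq
      have h22 (φ) := congrArg (fun B : H →L[ℂ] H => B φ)
        (P.oddX_commute (fun b => (h2 b).symm)).eq
      simp only [mul_apply_eq_comp] at h11 h12 h21 h22
      rw [commute_iff_eq]
      ext f x
      simp only [mul_apply_eq_comp, extX_apply, map_add, h11, h12, h21, h22, flipBit_comm x h]
      abel)
    (fun v w h => by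
      rw [commute_iff_eq]
      ext f x
      have h1 (φ) := congrArg (fun B : H →L[ℂ] H => B φ) (P.obs_commute v w .Z .Z h).eq
      simp only [mul_apply_eq_comp] at h1
      simp [extZ_apply, h1, smul_smul, mul_comm])
    (fun v w h => by
      rw [commute_iff_eq]
      ext f x
      have h1 (φ) := congrArg (fun B : H →L[ℂ] H => B φ)
        (P.evenX_commute fun b => P.obs_commute w v .Z b h.symm).eq
      have h2 (φ) := congrArg (fun B : H →L[ℂ] H => B φ)
        (P.oddX_commute fun b => P.obs_commute w v .Z b h.symm).eq
      simp only [mul_apply_eq_comp] at h1 h2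
      simp [extX_apply, extZ_apply, h1, h2, flipBit_of_ne x h.symm])

theorem ideal_isPauli (θ : V → ℝ) : (P.ideal θ).IsPauli θ where
  anticomm v φ := by
    ext x
    change P.extX v (P.extZ v φ) x = (-P.extZ v (P.extX v φ)) x
    simp only [extX_apply, extZ_apply, PiLp.neg_apply, map_add, evenX_apply, oddX_apply, map_sub,
      map_smul, obs_obs, flipBit_self, bitSign_add_one]
    module
  rot v t := rfl

theorem lift_commute_ideal (θ : V → ℝ) (v w : V) (b c : Query) (h : v ≠ w) :
    Commute (P.lift.obs v b) ((P.ideal θ).obs w c) := by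
  have hX : Commute (P.lift.obs v b) (P.extX w) :=
    Commute.extX P fun c => P.obs_commute v w b c h
  have hZ : Commute (P.lift.obs v b) (P.extZ w) :=
    Commute.extZ P fun c => P.obs_commute v w b c h
  cases c with
  | X => exact hX
  | Z => exact hZ
  | R t => exact (hX.smul_right _).add_right (hZ.smul_right _)

omit [DecidableEq V] in
theorem extZ_incl (v : V) (φ : H) : P.extZ v (Ext.incl φ) = Ext.incl (P.obs v .Z φ) := by
  ext x
  rw [extZ_apply]
  by_cases h : x = 0
  · subst h; simp [Ext.incl]
  · simp [Ext.incl, h]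

theorem lift_obs_incl (v : V) (b : Query) (φ : H) :
    P.lift.obs v b (Ext.incl φ) = Ext.incl (P.obs v b φ) := by
  ext x
  change P.obs v b _ = _
  by_cases h : x = 0
  · subst h; simp [Ext.incl]
  · simp [Ext.incl, h]

/-- Only the even part `E` errs: it lands on the flipped ancilla instead of `|0⟩`. This costs at
most `2‖E φ‖`, and `XZ + ZX = 2ZE`. -/
theorem norm_extX_incl_sub_le (v : V) (φ : H) :
    ‖P.extX v (Ext.incl φ) - Ext.incl (P.obs v .X φ)‖ ≤
      ‖P.obs v .X (P.obs v .Z φ) + P.obs v .Z (P.obs v .X φ)‖ := by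
  have h : P.extX v (Ext.incl φ) - Ext.incl (P.obs v .X φ) =
      PiLp.single 2 (flipBit 0 v) (P.evenX v φ) - PiLp.single 2 0 (P.evenX v φ) := by
    ext x
    simp only [PiLp.sub_apply, extX_apply, Ext.incl]
    by_cases h0 : x = 0
    · subst h0
      simp only [PiLp.single_eq_same, PiLp.single_eq_of_ne 2 (flipBit_ne 0 v),
        PiLp.single_eq_of_ne 2 (flipBit_ne 0 v).symm, map_zero, evenX_apply, oddX_apply]
      module
    · by_cases h1 : x = flipBit 0 v
      · subst h1
        simp [h0]
      · have h2 : flipBit x v ≠ 0 := fun h => h1 (by rw [← h, flipBit_flipBit])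
        simp [h0, h1, h2]
  have h2 : P.obs v .X (P.obs v .Z φ) + P.obs v .Z (P.obs v .X φ) =
      (2 : ℂ) • P.obs v .Z (P.evenX v φ) := by
    rw [evenX_apply]
    simp only [map_smul, map_add, obs_obs]
    module
  rw [h, h2, norm_smul, norm_obs]
  refine (norm_sub_le _ _).trans_eq ?_
  rw [PiLp.norm_single, PiLp.norm_single]
  norm_num
  ring

end Provers
end Extension

/-! ### Signs of the graph state. -/

section GraphSign

variable {V : Type*} [Fintype V] [DecidableEq V] (G : SimpleGraph V)

open Classical in
/-- The sign of the amplitude of the graph state at a bit string. -/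
noncomputable def edgeSign (x : V → Fin 2) : ℂ :=
  (-1) ^ (G.edgeFinset.filter fun e => ∀ v ∈ e, x v = 1).card

theorem graphState_apply (x : V → Fin 2) :
    graphState G x = edgeSign G x / (Real.sqrt (2 ^ Fintype.card V) : ℂ) := rfl

variable [DecidableRel G.Adj]

/-- The eigenvalue of `Z` on all neighbours of `v` at a bit string. -/
noncomputable def nbrSign (v : V) (x : V → Fin 2) : ℂ :=
  ∏ w, if G.Adj v w then bitSign (x w) else 1

omit [DecidableEq V] in
theorem nbrSign_mul_self (v : V) (x : V → Fin 2) : nbrSign G v x * nbrSign G v x = 1 := by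
  rw [nbrSign, ← Finset.prod_mul_distrib]
  refine Finset.prod_eq_one fun w _ => ?_
  split_ifs <;> simp

theorem nbrSign_flipBit (v : V) (x : V → Fin 2) : nbrSign G v (flipBit x v) = nbrSign G v x := by
  refine Finset.prod_congr rfl fun w _ => ?_
  by_cases h : w = v
  · subst h; simp
  · rw [flipBit_of_ne _ h]

/-- Only the edges at `v` change status, namely those whose other end has bit `1`. -/
theorem edgeSign_flipBit (v : V) (x : V → Fin 2) :
    edgeSign G (flipBit x v) = nbrSign G v x * edgeSign G x := by
  classical
  have hprod (y : V → Fin 2) : edgeSign G y =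
      (∏ w ∈ G.neighborFinset v, if y v = 1 ∧ y w = 1 then -1 else 1) *
        ∏ e ∈ G.edgeFinset.filter (fun e => v ∉ e), if ∀ u ∈ e, y u = 1 then -1 else 1 := by
    have h1 : edgeSign G y = ∏ e ∈ G.edgeFinset, if ∀ u ∈ e, y u = 1 then -1 else 1 := by
      rw [Finset.prod_ite, Finset.prod_const, Finset.prod_const_one, mul_one, edgeSign]
      congr!
    rw [h1, ← Finset.prod_filter_mul_prod_filter_not _ (fun e => v ∈ e)]
    congr 1
    symm
    refine Finset.prod_bij (fun w _ => s(v, w)) ?_ ?_ ?_ ?_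
    · intro w hw
      simpa using hw
    · exact fun w _ w' _ h => Sym2.congr_right.mp h
    · intro e he
      obtain ⟨he, hv⟩ := Finset.mem_filter.mp he
      obtain ⟨w, rfl⟩ := Sym2.mem_iff_exists.mp hv
      exact ⟨w, by simpa using he, rfl⟩
    · intro w _
      simp
  rw [hprod, hprod, nbrSign, ← mul_assoc]
  congr 1
  · rw [← Finset.prod_filter (G.Adj v), show Finset.univ.filter (G.Adj v) = G.neighborFinset v by
      ext; simp, ← Finset.prod_mul_distrib]
    refine Finset.prod_congr rfl fun w hw => ?_
    have hwv : w ≠ v := by rintro rfl; simp at hw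
    rw [flipBit_self, flipBit_of_ne _ hwv]
    generalize x v = a
    generalize x w = b
    fin_cases a <;> fin_cases b <;> simp [bitSign]
  · refine Finset.prod_congr rfl fun e he => ?_
    have hv := (Finset.mem_filter.mp he).2
    refine if_congr (forall₂_congr fun u hu => ?_) rfl rfl
    rw [flipBit_of_ne x (by rintro rfl; exact hv hu)]

end GraphSign

/-! ### The honest provers attain `cTest`. -/

section Honest

variable {V : Type*} [Fintype V] [DecidableEq V]

theorem localOp_apply (v : V) (M : Matrix (Fin 2) (Fin 2) ℂ) (x y : V → Fin 2) :
    localOp v M x y = if ∀ w, w ≠ v → x w = y w then M (x v) (y v) else 0 := by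
  have h : localOp v M x y = M (x v) (y v) * ∏ w ∈ {v}ᶜ, if x w = y w then 1 else 0 := by
    simp only [localOp, tensorOp, MonoidHom.coe_mk, OneHom.coe_mk, Matrix.of_apply]
    rw [Fintype.prod_eq_mul_prod_compl v, Pi.mulSingle_eq_same]
    congr 1
    refine Finset.prod_congr rfl fun w hw => ?_
    rw [Pi.mulSingle_eq_of_ne (by simpa using hw), Matrix.one_apply]
  rw [h, Finset.prod_ite_zero]
  simp

variable (G : SimpleGraph V) (θ : V → ℝ)

theorem honest_obs_X_apply (v : V) (f : Qubits V) (x : V → Fin 2) :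
    (honest G θ).obs v .X f x = f (flipBit x v) := by
  change ∑ y, localOp v _ x y * f y = _
  rw [Fintype.sum_eq_single (flipBit x v)]
  · rw [localOp_apply, if_pos fun w hw => (flipBit_of_ne x hw).symm, flipBit_self, idealObs]
    generalize x v = a
    fin_cases a <;> simp
  · intro y hy
    rw [localOp_apply]
    split_ifs with h
    · have : y v = x v := by
        by_contra hne
        refine hy (funext fun w => ?_)
        by_cases hw : w = v
        · subst hw
          rw [flipBit_self]
          revert hne
          generalize y w = a
          generalize x w = b
          fin_cases a <;> fin_cases b <;> simp
        · rw [flipBit_of_ne x hw, h w hw]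
      rw [this, idealObs]
      generalize x v = a
      fin_cases a <;> simp
    · simp

theorem honest_obs_Z_apply (v : V) (f : Qubits V) (x : V → Fin 2) :
    (honest G θ).obs v .Z f x = bitSign (x v) * f x := by
  change ∑ y, localOp v _ x y * f y = _
  rw [Fintype.sum_eq_single x]
  · rw [localOp_apply, if_pos fun w hw => rfl, idealObs]
    generalize x v = a
    fin_cases a <;> simp [bitSign]
  · intro y hy
    rw [localOp_apply]
    split_ifs with h
    · have : x v ≠ y v := by
        intro hv
        refine hy (funext fun w => ?_)
        by_cases hw : w = v
        · subst hw; exact hv.symm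
        · exact (h w hw).symm
      rw [idealObs]
      revert this
      generalize x v = a
      generalize y v = b
      fin_cases a <;> fin_cases b <;> simp
    · simp

theorem honest_isPauli : (honest G θ).IsPauli θ where
  anticomm v φ := by
    ext x
    simp [honest_obs_X_apply, honest_obs_Z_apply]
  rot v t := by
    change Matrix.toEuclideanCLM (𝕜 := ℂ) _ = _ • Matrix.toEuclideanCLM (𝕜 := ℂ) _ +
      _ • Matrix.toEuclideanCLM (𝕜 := ℂ) _
    rw [← map_smul, ← map_smul, ← map_add]
    congr 1
    ext x y
    simp only [Matrix.add_apply, Matrix.smul_apply, localOp_apply]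
    split_ifs
    · rw [idealObs, idealObs, idealObs]
      rfl
    · simp

variable [DecidableRel G.Adj]

omit [DecidableEq V] in
theorem qstr_nbrQuery_intertwine {H E : Type*} [NormedAddCommGroup H] [InnerProductSpace ℂ H]
    [CompleteSpace H] (P : Provers V H) [AddCommGroup E] [Module ℂ E] (J : H → E) (x : V → Fin 2)
    (hJ : ∀ v φ, J (P.obs v .Z φ) = bitSign (x v) • J φ) (v : V) (φ : H) :
    J (P.qstr (nbrQuery G v) φ) = nbrSign G v x • J φ := by
  refine P.str_intertwine_smul J (fun w φ => ?_) φ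
  by_cases h : G.Adj v w <;> simp [nbrQuery, h, queryPoly, hJ]

/-- The sign produced by flipping the bit at `v` is the sign produced by the `Z` on its neighbours,
and the two cancel. -/
theorem honest_stabilizer (v : V) :
    (honest G θ).qstr (vertexQuery G v) (graphState G) = graphState G := by
  rw [Provers.qstr_vertexQuery, mul_apply_eq_comp]
  ext x
  rw [honest_obs_X_apply]
  have h := qstr_nbrQuery_intertwine G (honest G θ) (fun f => f (flipBit x v)) (flipBit x v)
    (fun w f => honest_obs_Z_apply G θ w f _) v (graphState G)
  simp only at h
  rw [h, graphState_apply, graphState_apply, edgeSign_flipBit, nbrSign_flipBit, smul_eq_mul,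
    ← mul_div_assoc, ← mul_assoc, nbrSign_mul_self, one_mul]

/-- Exact Pauli observables on a stabilised state attain the acceptance probability `cTest`. -/
theorem Provers.IsPauli.acceptProb_eq [Nonempty V] {H : Type*} [NormedAddCommGroup H]
    [InnerProductSpace ℂ H] [CompleteSpace H] {P : Provers V H} {θ : V → ℝ} (hP : P.IsPauli θ)
    (hstab : ∀ v, P.qstr (vertexQuery G v) P.state = P.state)
    (T : Finset (Finset V)) (hT : ∀ τ ∈ T, G.IsNClique 3 τ) (nb : V → V)
    (hnb : ∀ v, G.Adj v (nb v)) (hθ : ∀ v, 0 ≤ θ v ∧ θ v ≤ Real.pi / 2)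
    (hcs : ∀ v, 0 < Real.cos (θ v) + |Real.sin (θ v)|) :
    acceptProb G T nb θ P = cTest T θ := by
  have hS (v : V) : P.stabErr G v = 0 := by simp [stabErr, hstab]
  have hτ (τ : Finset V) (h : τ ∈ T) : P.triangleErr G τ = 0 := by
    obtain ⟨a, b, c, hab, hac, hbc, rfl⟩ := SimpleGraph.is3Clique_iff.mp (hT τ h)
    have h := congrArg (fun A : H →L[ℂ] H => A P.state) (P.qstr_triangle hab hac hbc)
    simp only [mul_apply_eq_comp, hstab, hP.anticomm, map_neg, obs_obs] at h
    rw [triangleErr]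
    nth_rewrite 2 [h]
    simp
  have hR (v : V) : P.rotErr G nb θ v = 0 := by
    have hA : P.qstr (nbrQuery G v) P.state = P.obs v .X P.state :=
      sub_eq_zero.mp (norm_eq_zero.mp (by rw [norm_nbr_sub, hstab, sub_self, norm_zero]))
    have hB : P.qstr (sideQuery G v (nb v)) P.state = P.obs v .Z P.state :=
      sub_eq_zero.mp (norm_eq_zero.mp (by rw [norm_side_sub P (hnb v), hstab, sub_self, norm_zero]))
    have hs : |Real.sin (θ v)| = Real.sin (θ v) :=
      abs_of_nonneg (Real.sin_nonneg_of_nonneg_of_le_pi (hθ v).1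
        ((hθ v).2.trans (by linarith [Real.pi_pos])))
    refine Finset.sum_eq_zero fun t _ => ?_
    rw [hA, hB, hs, hP.rot]
    rcases Int.units_eq_one_or t with rfl | rfl <;> simp
  have h := P.deficit_eq G T nb θ hcs
  rw [Finset.sum_eq_zero (s := T) fun τ h => by rw [hτ τ h, zero_div]] at h
  simp only [hS, hR, zero_div, Finset.sum_const_zero, add_zero, mul_eq_zero,
    (numSubtests_pos T).ne', false_or] at h
  linarith

end Honest
-- Embedding the honest system at a stabilised vector.
namespace Provers

variable {V : Type*} [Fintype V] {H : Type*} [NormedAddCommGroup H]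
  [InnerProductSpace ℂ H] [CompleteSpace H] (Q : Provers V H)

/-- `str` as a multilinear map. -/
noncomputable def strMultilinear : MultilinearMap ℂ (fun _ : V => Poly) (H →L[ℂ] H) where
  toFun := Q.str
  map_update_add' f v a b := by
    have h (c : Poly) : Q.str (Function.update f v c) =
        Q.ev v c * Q.str (Function.update f v 1) :=
      Q.str_eq_ev_mul v c (by simp) fun w hw => by simp [hw]
    rw [h, h a, h b, map_add, add_mul]
  map_update_smul' f v r a := by
    have h (c : Poly) : Q.str (Function.update f v c) =
        Q.ev v c * Q.str (Function.update f v 1) :=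
      Q.str_eq_ev_mul v c (by simp) fun w hw => by simp [hw]
    rw [h, h a, map_smul, smul_mul_assoc]

/-- The polynomial of the spectral projection of `Z` at a bit. -/
noncomputable def _root_.OneShotTest.zProj (b : Fin 2) : Poly :=
  (1 / 2 : ℂ) • (1 + bitSign b • qvar .Z)

/-- The product of the spectral projections of `Z` at a bit string. -/
noncomputable def zStr (x : V → Fin 2) : H →L[ℂ] H := Q.str fun v => zProj (x v)

/-- Expand the product over `v` of the sums of the two spectral projections of `Z`, each sum being
`1`. -/
theorem sum_zStr [DecidableEq V] : ∑ x, Q.zStr x = 1 := by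
  have h : ∑ b, zProj b = 1 := by
    simp only [Fin.sum_univ_two, zProj, bitSign]
    simp only [Fin.val_zero, Fin.val_one, pow_zero, pow_one]
    module
  have := Q.strMultilinear.map_sum (fun _ b => zProj b)
  rw [h] at this
  exact this.symm.trans (map_one Q.str)

variable [DecidableEq V]

theorem obs_Z_zStr (v : V) (x : V → Fin 2) : Q.obs v .Z * Q.zStr x = bitSign (x v) • Q.zStr x := by
  have h1 : Q.obs v .Z * Q.zStr x =
      Q.str (Pi.mulSingle v (qvar .Z) * fun v => zProj (x v)) := by
    rw [map_mul, str_mulSingle, ev_qvar, zStr]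
  have h2 : bitSign (x v) • Q.zStr x = Q.ev v (algebraMap ℂ Poly (bitSign (x v))) * Q.zStr x := by
    rw [AlgHom.commutes, ← Algebra.smul_def]
  rw [h1, h2, zStr]
  refine Q.str_eq_ev_mul v _ ?_ fun w hw => ?_
  · rw [Pi.mul_apply, Pi.mulSingle_eq_same, ← Algebra.smul_def]
    simp only [zProj, map_mul, map_smul, map_add, map_one, ev_qvar, mul_smul_comm, mul_add,
      mul_one, obs_sq, smul_add, smul_smul]
    have : bitSign (x v) * (1 / 2 * bitSign (x v)) = 1 / 2 := by
      linear_combination (1 / 2) * bitSign_mul_self (x v)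
    rw [this, add_comm, mul_comm (1 / 2) (bitSign (x v))]
  · simp [Pi.mulSingle_eq_of_ne hw]

theorem zStr_obs_Z (v : V) (x : V → Fin 2) : Q.zStr x * Q.obs v .Z = bitSign (x v) • Q.zStr x := by
  rw [← obs_Z_zStr, zStr, ← ev_qvar, ← str_mulSingle, ← map_mul, ← map_mul]
  refine Q.str_congr fun w => ?_
  by_cases hw : w = v
  · subst hw; simp [zProj, mul_add, add_mul]
  · simp [Pi.mulSingle_eq_of_ne hw]

variable {Q} {θ : V → ℝ}

theorem IsPauli.obs_X_zStr (hQ : Q.IsPauli θ) (v : V) (x : V → Fin 2) :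
    Q.obs v .X * Q.zStr x = Q.zStr (flipBit x v) * Q.obs v .X := by
  have hanti : Q.obs v .X * Q.obs v .Z = -(Q.obs v .Z * Q.obs v .X) :=
    ContinuousLinearMap.ext fun φ => hQ.anticomm v φ
  rw [zStr, zStr, ← ev_qvar, ← str_mulSingle, ← map_mul, ← map_mul]
  refine Q.str_congr fun w => ?_
  by_cases hw : w = v
  · subst hw; simp [zProj, mul_add, add_mul, hanti]
  · simp [Pi.mulSingle_eq_of_ne hw, flipBit_of_ne x hw]

variable {G : SimpleGraph V} [DecidableRel G.Adj]

section Embedding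

variable (Q G)

/-- The image of a basis vector of the qubits under the embedding that maps the graph state
to `g`. -/
noncomputable def basisImage (g : H) (x : V → Fin 2) : H :=
  ((Real.sqrt (2 ^ Fintype.card V) : ℂ) * edgeSign G x) • Q.zStr x g

/-- The linear map from the qubits that maps the graph state to `g`. -/
noncomputable def embed (g : H) : Qubits V →ₗ[ℂ] H where
  toFun c := ∑ x, c x • basisImage Q G g x
  map_add' c d := by simp [add_smul, Finset.sum_add_distrib]
  map_smul' r c := by simp [Finset.smul_sum, smul_smul]

variable {Q G}

omit [DecidableRel G.Adj] in
theorem obs_Z_basisImage (g : H) (v : V) (x : V → Fin 2) :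
    Q.obs v .Z (basisImage Q G g x) = bitSign (x v) • basisImage Q G g x := by
  have := congrArg (fun A : H →L[ℂ] H => A g) (Q.obs_Z_zStr v x)
  simp only [mul_apply_eq_comp, smul_apply] at this
  rw [basisImage, map_smul, this, smul_comm]

variable {g : H} (hg : ∀ v, Q.qstr (vertexQuery G v) g = g)
include hg

/-- `X` carries one joint eigenspace of the `Z` to another, and stabilisation trades `X g` for a
string of `Z`; its sign there is the change of `edgeSign`. -/
theorem IsPauli.obs_X_basisImage (hQ : Q.IsPauli θ) (v : V) (x : V → Fin 2) :
    Q.obs v .X (basisImage Q G g x) = basisImage Q G g (flipBit x v) := by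
  have h := congrArg (fun A : H →L[ℂ] H => A g) (hQ.obs_X_zStr v x)
  simp only [mul_apply_eq_comp] at h
  have hX : Q.obs v .X g = Q.qstr (nbrQuery G v) g := by
    have := hg v
    rw [qstr_vertexQuery, mul_apply_eq_comp] at this
    nth_rewrite 1 [← this]
    rw [obs_obs]
  have hJ := qstr_nbrQuery_intertwine G Q (Q.zStr (flipBit x v)) (flipBit x v)
    (fun w φ => by
      simpa using congrArg (fun A : H →L[ℂ] H => A φ) (Q.zStr_obs_Z w (flipBit x v))) v g
  rw [basisImage, map_smul, h, hX, hJ, smul_smul, basisImage, edgeSign_flipBit, nbrSign_flipBit]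
  congr 1
  ring

/-- The isometries `X` connect all bit strings; the bits of the support are flipped one at a time.
-/
theorem IsPauli.norm_basisImage (hQ : Q.IsPauli θ) (x : V → Fin 2) :
    ‖basisImage Q G g x‖ = ‖basisImage Q G g 0‖ := by
  have h (s : Finset V) : ‖basisImage Q G g (fun v => if v ∈ s then 1 else 0)‖ =
      ‖basisImage Q G g 0‖ := by
    induction s using Finset.induction_on with
    | empty => simp; rfl
    | insert v s hv ih =>
      rw [← ih, ← Q.norm_obs v .X, hQ.obs_X_basisImage hg]
      congr 2
      ext w : 1
      by_cases hw : w = v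
      · subst hw; simp [hv]
      · simp [flipBit_of_ne _ hw, hw]
  rw [← h (Finset.univ.filter fun v => x v = 1)]
  congr 2
  ext v : 1
  simp only [Finset.mem_filter, Finset.mem_univ, true_and]
  generalize x v = a
  fin_cases a <;> simp

omit hg [DecidableRel G.Adj] in
theorem inner_basisImage {x y : V → Fin 2} (h : x ≠ y) :
    inner ℂ (basisImage Q G g x) (basisImage Q G g y) = 0 := by
  obtain ⟨v, hv⟩ := Function.ne_iff.mp h
  have h1 := Q.inner_obs v .Z (basisImage Q G g x) (basisImage Q G g y)
  rw [obs_Z_basisImage, obs_Z_basisImage, inner_smul_left, inner_smul_right, star_bitSign] at h1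
  revert h1 hv
  generalize x v = a
  generalize y v = b
  intro hv h1
  have h2 : bitSign a = -bitSign b := by
    revert hv
    fin_cases a <;> fin_cases b <;> simp [bitSign]
  rw [h2] at h1
  have h3 : (2 * bitSign b) * inner ℂ (basisImage Q G g x) (basisImage Q G g y) = 0 := by
    linear_combination -h1
  have h4 : bitSign b ≠ 0 := fun h0 => by simpa [h0] using bitSign_mul_self b
  simpa [h4] using h3

omit hg [DecidableRel G.Adj] in
-- The coefficient in `basisImage` is inverse to the amplitude of the graph state, which leaves the
-- resolution of identity `sum_zStr`.
theorem embed_graphState : embed Q G g (graphState G) = g := by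
  have hsqrt : (Real.sqrt (2 ^ Fintype.card V) : ℂ) ≠ 0 := by
    rw [Complex.ofReal_ne_zero]; positivity
  have hsign (x : V → Fin 2) : edgeSign G x * edgeSign G x = 1 := by
    rw [edgeSign, ← mul_pow]; simp
  have h (x : V → Fin 2) : graphState G x • basisImage Q G g x = Q.zStr x g := by
    rw [basisImage, smul_smul, graphState_apply, ← mul_assoc, div_mul_cancel₀ _ hsqrt, hsign,
      one_smul]
  change ∑ x, graphState G x • basisImage Q G g x = g
  simp only [h]
  rw [← sum_apply, sum_zStr, one_apply_eq_self]

/-- The basis images are orthogonal and of equal norm; the common scale is read off at the graph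
state. The case `g = 0` is allowed. -/
theorem IsPauli.norm_embed (hQ : Q.IsPauli θ) (c : Qubits V) :
    ‖embed Q G g c‖ = ‖g‖ * ‖c‖ := by
  have h (c : Qubits V) : ‖embed Q G g c‖ = ‖basisImage Q G g 0‖ * ‖c‖ := by
    rw [← sq_eq_sq₀ (norm_nonneg _) (by positivity), mul_pow, PiLp.norm_sq_eq_of_L2,
      Finset.mul_sum, ← inner_self_eq_norm_sq (𝕜 := ℂ)]
    change RCLike.re (inner ℂ (∑ x, c x • basisImage Q G g x) (∑ x, c x • basisImage Q G g x)) = _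
    rw [sum_inner, map_sum]
    refine Finset.sum_congr rfl fun x _ => ?_
    rw [inner_sum, Finset.sum_eq_single x]
    · rw [inner_self_eq_norm_sq, norm_smul, mul_pow, hQ.norm_basisImage hg, mul_comm]
    · intro y _ hy
      rw [inner_smul_left, inner_smul_right, inner_basisImage hy.symm, mul_zero, mul_zero]
    · simp
  have h1 := h (graphState G)
  rw [embed_graphState, norm_graphState, mul_one] at h1
  rw [h, h1]

theorem IsPauli.embed_obs (hQ : Q.IsPauli θ) (v : V) (b : Query) (c : Qubits V) :
    embed Q G g ((honest G θ).obs v b c) = Q.obs v b (embed Q G g c) := by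
  have hX (c : Qubits V) : embed Q G g ((honest G θ).obs v .X c) =
      Q.obs v .X (embed Q G g c) := by
    change ∑ x, (honest G θ).obs v .X c x • basisImage Q G g x =
      Q.obs v .X (∑ x, c x • basisImage Q G g x)
    simp only [map_sum, map_smul, hQ.obs_X_basisImage hg, honest_obs_X_apply]
    refine Fintype.sum_equiv (flipEquiv v) _ _ fun x => ?_
    simp [flipEquiv]
  have hZ (c : Qubits V) : embed Q G g ((honest G θ).obs v .Z c) =
      Q.obs v .Z (embed Q G g c) := by
    change ∑ x, (honest G θ).obs v .Z c x • basisImage Q G g x =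
      Q.obs v .Z (∑ x, c x • basisImage Q G g x)
    simp only [map_sum, map_smul, obs_Z_basisImage, honest_obs_Z_apply, smul_smul, mul_comm]
  cases b with
  | X => exact hX c
  | Z => exact hZ c
  | R t =>
    rw [hQ.rot, (honest_isPauli G θ).rot]
    simp only [add_apply, smul_apply, map_add, map_smul, hX, hZ]

/-- On a stabilised vector, exact Pauli observables have the outcome probabilities of the honest
provers. -/
theorem IsPauli.weight_eq_honest (hQ : Q.IsPauli θ) {Ω : Type*} (x : Ω) (p : Pattern V Ω) :
    Q.weight x p g = ‖g‖ ^ 2 * (honest G θ).outcomeProb p x := by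
  have h := (honest G θ).weight_map x Q (embed Q G g) ‖g‖ (hQ.norm_embed hg) (hQ.embed_obs hg) p
    (graphState G)
  rwa [embed_graphState] at h

end Embedding

/-! ### A common fixed vector of the stabilisers. -/

section Stabilised

omit [DecidableEq V] in
theorem qstr_qstr (q : V → Option Query) (φ : H) : Q.qstr q (Q.qstr q φ) = φ := by
  have h : Q.qstr q * Q.qstr q = 1 := by
    rw [qstr, ← map_mul, ← map_one Q.str]
    refine Q.str_congr fun v => ?_
    cases hq : q v <;> simp [hq, queryPoly, obs_sq]
  simpa using congrArg (fun A : H →L[ℂ] H => A φ) h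

/-- For adjacent vertices `X` meets `Z` at both of them, and the two signs `ε` cancel; elsewhere the
factors commute. -/
theorem IsPauli.commute_vertexQuery (hQ : Q.IsPauli θ) (v w : V) :
    Commute (Q.qstr (vertexQuery G v)) (Q.qstr (vertexQuery G w)) := by
  by_cases hvw : w = v
  · subst hvw; exact Commute.refl _
  have hvw' : v ≠ w := fun h => hvw h.symm
  have hanti (v : V) : Q.obs v .X * Q.obs v .Z = -(Q.obs v .Z * Q.obs v .X) :=
    ContinuousLinearMap.ext fun φ => hQ.anticomm v φ
  set a : V → Poly := fun u => queryPoly (vertexQuery G v u) with ha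
  set b : V → Poly := fun u => queryPoly (vertexQuery G w u) with hb
  set ε : ℂ := if G.Adj v w then -1 else 1 with hε
  have h1 : Q.str (a * b) = Q.ev v (algebraMap ℂ Poly ε) *
      Q.str (Function.update (a * b) v (b v * a v)) := by
    refine Q.str_eq_ev_mul v _ ?_ fun u hu => by simp [hu]
    by_cases h : G.Adj v w
    · simp [ha, hb, hε, h, h.symm, vertexQuery, queryPoly, hvw', hanti]
    · have h' : ¬ G.Adj w v := fun h' => h h'.symm
      simp [ha, hb, hε, h, h', vertexQuery, queryPoly, hvw']
  have h2 : Q.str (Function.update (a * b) v (b v * a v)) = Q.ev w (algebraMap ℂ Poly ε) *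
      Q.str (b * a) := by
    refine Q.str_eq_ev_mul w _ ?_ fun u hu => ?_
    · by_cases h : G.Adj v w
      · simp [ha, hb, hε, h, h.symm, vertexQuery, queryPoly, hvw, hanti]
      · have h' : ¬ G.Adj w v := fun h' => h h'.symm
        simp [ha, hb, hε, h, h', vertexQuery, queryPoly, hvw]
    · by_cases huv : u = v
      · subst huv; simp
      · simp only [Function.update_of_ne huv, Pi.mul_apply, ha, hb, vertexQuery, huv, hu, if_false]
        split_ifs <;> simp [queryPoly]
  have hεε : ε * ε = 1 := by rw [hε]; split_ifs <;> simp
  rw [commute_iff_eq]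
  change Q.str a * Q.str b = Q.str b * Q.str a
  rw [← map_mul, ← map_mul, h1, h2, AlgHom.commutes, AlgHom.commutes, ← mul_assoc, ← map_mul, hεε,
    map_one, one_mul]

/-- Apply the averages `(1 + S v) / 2` in turn. Each moves the vector by at most `e / 2`; since the
`S v` commute, it keeps earlier fixed-point relations and does not worsen the other errors. -/
theorem IsPauli.exists_stabilised (hQ : Q.IsPauli θ) {e : ℝ} {φ : H}
    (hφ : ∀ v, ‖Q.qstr (vertexQuery G v) φ - φ‖ ≤ e) :
    ∃ g, (∀ v, Q.qstr (vertexQuery G v) g = g) ∧ ‖g‖ ≤ ‖φ‖ ∧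
      ‖φ - g‖ ≤ Fintype.card V * (e / 2) := by
  set S := fun v => Q.qstr (vertexQuery G v) with hS
  have hSn (v : V) (χ : H) : ‖S v χ‖ = ‖χ‖ := Q.norm_qstr _ χ
  have hcomm (v w : V) (χ : H) : S v (S w χ) = S w (S v χ) :=
    congrArg (fun A : H →L[ℂ] H => A χ) (hQ.commute_vertexQuery v w).eq
  have key (s : Finset V) : ∃ g, (∀ v ∈ s, S v g = g) ∧ (∀ v, ‖S v g - g‖ ≤ e) ∧ ‖g‖ ≤ ‖φ‖ ∧
      ‖φ - g‖ ≤ s.card * (e / 2) := by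
    induction s using Finset.induction_on with
    | empty => exact ⟨φ, by simp, hφ, le_rfl, by simp⟩
    | insert v s hv ih =>
      obtain ⟨g, h1, h2, h3, h4⟩ := ih
      have half (χ : H) : ‖(1 / 2 : ℂ) • χ‖ = ‖χ‖ / 2 := by
        rw [norm_smul]; norm_num; ring
      refine ⟨(1 / 2 : ℂ) • (g + S v g), ?_, ?_, ?_, ?_⟩
      · intro w hw
        rcases Finset.mem_insert.mp hw with rfl | hw
        · have : S w (S w g) = g := qstr_qstr _ g
          rw [map_smul, map_add, this, add_comm]
        · rw [map_smul, map_add, hcomm, h1 w hw]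
      · intro w
        have : S w ((1 / 2 : ℂ) • (g + S v g)) - (1 / 2 : ℂ) • (g + S v g) =
            (1 / 2 : ℂ) • ((S w g - g) + S v (S w g - g)) := by
          rw [map_smul, map_add, map_sub, hcomm w v]
          module
        rw [this, half]
        have := norm_add_le (S w g - g) (S v (S w g - g))
        rw [hSn] at this
        linarith [h2 w]
      · rw [half]
        have := norm_add_le g (S v g)
        rw [hSn] at this
        linarith
      · have : φ - (1 / 2 : ℂ) • (g + S v g) = (φ - g) - (1 / 2 : ℂ) • (S v g - g) := by module
        rw [this, Finset.card_insert_of_notMem hv]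
        refine (norm_sub_le _ _).trans ?_
        rw [half]
        push_cast
        linarith [h2 v]
  obtain ⟨g, h1, -, h3, h4⟩ := key Finset.univ
  exact ⟨g, fun v => h1 v (Finset.mem_univ v), h3, h4⟩

end Stabilised

end Provers

/-! ### Adding up the losses. -/

namespace Provers

variable {V : Type*} [Fintype V] [DecidableEq V] {H : Type*} [NormedAddCommGroup H]
  [InnerProductSpace ℂ H] [CompleteSpace H] (P : Provers V H)

theorem outcomeProb_lift {Ω : Type*} (p : Pattern V Ω) (x : Ω) :
    P.lift.outcomeProb p x = P.outcomeProb p x := by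
  let J : H →ₗ[ℂ] Ext V H :=
    { toFun := Ext.incl
      map_add' := fun a b => PiLp.single_add 2 _
      map_smul' := fun r a => by
        ext y
        by_cases h : y = 0
        · subst h; simp [Ext.incl]
        · simp [Ext.incl, h] }
  have h := P.weight_map x P.lift J 1 (fun φ => by rw [one_mul]; exact Ext.norm_incl φ)
    (fun v b φ => (P.lift_obs_incl v b φ).symm) p P.state
  rw [one_pow, one_mul] at h
  exact h

variable {G : SimpleGraph V} [DecidableRel G.Adj] {P} {d : ℝ}

/-- Small errors in the subtests force the observables `R(±θ)` to act on the state nearly as their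
expansion in `X` and `Z`. -/
theorem norm_rot_sub_le {nb : V → V} (hnb : ∀ v, G.Adj v (nb v)) {θ : V → ℝ}
    (hθ : ∀ v, 0 ≤ θ v ∧ θ v ≤ Real.pi / 2)
    (hs : ∀ v, ‖P.qstr (vertexQuery G v) P.state - P.state‖ ≤ 2 * d)
    (v : V) (hr : P.rotErr G nb θ v ≤ (3 * d) ^ 2) (hd : 0 ≤ d) (t : ℤˣ) :
    ‖P.obs v (.R t) P.state - ((Real.cos ((t : ℤ) * θ v) : ℂ) • P.obs v .X P.state +
      (Real.sin ((t : ℤ) * θ v) : ℂ) • P.obs v .Z P.state)‖ ≤ 7 * d := by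
  -- The test weights contain `|sin θ|`; the range of the angle turns this into `sin θ`.
  have hsin : 0 ≤ Real.sin (θ v) := Real.sin_nonneg_of_nonneg_of_le_pi (hθ v).1
    ((hθ v).2.trans (by linarith [Real.pi_pos]))
  set c := Real.cos ((t : ℤ) * θ v) with hc
  set s := Real.sin ((t : ℤ) * θ v) with hs'
  have hc1 : Real.cos (θ v) = c := by
    rcases Int.units_eq_one_or t with rfl | rfl <;> simp [hc]
  have hs1 : (t : ℤ) * |Real.sin (θ v)| = s := by
    rw [abs_of_nonneg hsin]
    rcases Int.units_eq_one_or t with rfl | rfl <;> simp [hs']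
  have h0 : ‖P.obs v (.R t) P.state - ((c : ℂ) • P.qstr (nbrQuery G v) P.state +
      (s : ℂ) • P.qstr (sideQuery G v (nb v)) P.state)‖ ≤ 3 * d := by
    rw [← sq_le_sq₀ (norm_nonneg _) (by positivity)]
    refine le_trans ?_ hr
    have := Finset.single_le_sum (f := fun t : ℤˣ => ‖P.obs v (.R t) P.state -
      (((Real.cos (θ v) : ℝ) : ℂ) • P.qstr (nbrQuery G v) P.state +
      (((t : ℤ) * |Real.sin (θ v)| : ℝ) : ℂ) • P.qstr (sideQuery G v (nb v)) P.state)‖ ^ 2)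
      (fun _ _ => by positivity) (Finset.mem_univ t)
    rw [hs1, hc1] at this
    rwa [rotErr, hc1]
  have hA : ‖(c : ℂ) • (P.qstr (nbrQuery G v) P.state - P.obs v .X P.state)‖ ≤ 2 * d := by
    rw [norm_smul, norm_nbr_sub, Complex.norm_real]
    exact (mul_le_of_le_one_left (norm_nonneg _) (Real.abs_cos_le_one _)).trans (hs v)
  have hB : ‖(s : ℂ) • (P.qstr (sideQuery G v (nb v)) P.state - P.obs v .Z P.state)‖ ≤ 2 * d := by
    rw [norm_smul, norm_side_sub P (hnb v), Complex.norm_real]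
    exact (mul_le_of_le_one_left (norm_nonneg _) (Real.abs_sin_le_one _)).trans (hs (nb v))
  have heq : P.obs v (.R t) P.state - ((c : ℂ) • P.obs v .X P.state +
      (s : ℂ) • P.obs v .Z P.state) =
      (P.obs v (.R t) P.state - ((c : ℂ) • P.qstr (nbrQuery G v) P.state +
        (s : ℂ) • P.qstr (sideQuery G v (nb v)) P.state)) +
      (c : ℂ) • (P.qstr (nbrQuery G v) P.state - P.obs v .X P.state) +
      (s : ℂ) • (P.qstr (sideQuery G v (nb v)) P.state - P.obs v .Z P.state) := by
    module
  rw [heq]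
  exact (norm_add₃_le).trans (by linarith)

/-- If the state nearly satisfies the relations of the honest provers, then the outcome
probabilities of adaptive patterns are close to the honest ones. -/
theorem abs_outcomeProb_sub_honest_le [Nonempty V] {θ : V → ℝ} (hd : 0 < d) (hd1 : d ≤ 1)
    (hs : ∀ v, ‖P.qstr (vertexQuery G v) P.state - P.state‖ ≤ 2 * d)
    (ha : ∀ v, ‖P.obs v .X (P.obs v .Z P.state) + P.obs v .Z (P.obs v .X P.state)‖ ≤ 8 * d)
    (hr : ∀ v t, ‖P.obs v (.R t) P.state - ((Real.cos ((t : ℤ) * θ v) : ℂ) • P.obs v .X P.state +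
      (Real.sin ((t : ℤ) * θ v) : ℂ) • P.obs v .Z P.state)‖ ≤ 7 * d)
    {Ω : Type*} (p : Pattern V Ω) (x : Ω) (hp : p.QueriesOnce ∅) :
    |P.outcomeProb p x - (honest G θ).outcomeProb p x| ≤ 600 * (Fintype.card V : ℝ) ^ 2 * d := by
  set Q := P.ideal θ with hQdef
  have hQ : Q.IsPauli θ := P.ideal_isPauli θ
  set ψ : Ext V H := Ext.incl P.state with hψ
  have hψ1 : ‖ψ‖ = 1 := P.lift.norm_state
  have hn : (1 : ℝ) ≤ Fintype.card V := by exact_mod_cast Fintype.card_pos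
  set n : ℝ := (Fintype.card V : ℝ) with hndef
  have hX (v : V) : ‖Q.obs v .X ψ - Ext.incl (P.obs v .X P.state)‖ ≤ 8 * d :=
    (P.norm_extX_incl_sub_le v P.state).trans (ha v)
  have hZ (v : V) (φ : H) : Q.obs v .Z (Ext.incl φ) = Ext.incl (P.obs v .Z φ) := P.extZ_incl v φ
  have hinv : (1 + 1 / d) * d ^ 2 ≤ 2 * d := by
    have : (1 + 1 / d) * d ^ 2 = d ^ 2 + d := by field_simp
    nlinarith
  -- `514 = 8² + 0 + 2 · 15²` for `X`, `Z` and the two `R`, where `15 = 7 + 8` adds the error of the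
  -- expansion to that of `X`.
  have hdist (v : V) : P.lift.obsDist Q v ψ ≤ 514 * d ^ 2 := by
    have h1 : ‖P.lift.obs v .X ψ - Q.obs v .X ψ‖ ^ 2 ≤ (8 * d) ^ 2 := by
      rw [lift_obs_incl, norm_sub_rev]
      exact pow_le_pow_left₀ (norm_nonneg _) (hX v) 2
    have h2 : ‖P.lift.obs v .Z ψ - Q.obs v .Z ψ‖ ^ 2 = 0 := by
      rw [lift_obs_incl, hZ, sub_self, norm_zero, sq, mul_zero]
    have h3 (t : ℤˣ) : ‖P.lift.obs v (.R t) ψ - Q.obs v (.R t) ψ‖ ^ 2 ≤ (15 * d) ^ 2 := by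
      refine pow_le_pow_left₀ (norm_nonneg _) ?_ 2
      have hincl : P.lift.obs v (.R t) ψ -
          ((Real.cos ((t : ℤ) * θ v) : ℂ) • P.lift.obs v .X ψ +
            (Real.sin ((t : ℤ) * θ v) : ℂ) • P.lift.obs v .Z ψ) =
          Ext.incl (P.obs v (.R t) P.state - ((Real.cos ((t : ℤ) * θ v) : ℂ) •
            P.obs v .X P.state + (Real.sin ((t : ℤ) * θ v) : ℂ) • P.obs v .Z P.state)) := by
        ext y
        change P.obs v (.R t) (ψ y) - ((Real.cos ((t : ℤ) * θ v) : ℂ) • P.obs v .X (ψ y) +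
          (Real.sin ((t : ℤ) * θ v) : ℂ) • P.obs v .Z (ψ y)) = _
        by_cases h : y = 0
        · subst h; simp [hψ, Ext.incl]
        · simp [hψ, Ext.incl, h]
      have heq : P.lift.obs v (.R t) ψ - Q.obs v (.R t) ψ =
          (P.lift.obs v (.R t) ψ - ((Real.cos ((t : ℤ) * θ v) : ℂ) • P.lift.obs v .X ψ +
            (Real.sin ((t : ℤ) * θ v) : ℂ) • P.lift.obs v .Z ψ)) -
          (Real.cos ((t : ℤ) * θ v) : ℂ) • (Q.obs v .X ψ - P.lift.obs v .X ψ) := by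
        rw [hQ.rot, add_apply, smul_apply, smul_apply, hZ, P.lift_obs_incl v .Z]
        module
      rw [heq, hincl]
      refine (norm_sub_le _ _).trans ?_
      rw [Ext.norm_incl, norm_smul, Complex.norm_real, lift_obs_incl]
      have := mul_le_of_le_one_left (norm_nonneg (Q.obs v .X ψ - Ext.incl (P.obs v .X P.state)))
        (Real.abs_cos_le_one ((t : ℤ) * θ v))
      rw [Real.norm_eq_abs]
      linarith [hr v t, hX v]
    rw [obsDist, h2, sum_intUnits]
    linarith [h3 1, h3 (-1)]
  have hhyb : |P.outcomeProb p x - Q.weight x p ψ| ≤ 515 * n * d := by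
    rw [← outcomeProb_lift]
    have h := abs_weight_sub_weight_le (P.lift_commute_ideal θ) hd x p ∅ hp ψ
    refine h.trans ?_
    simp only [Set.mem_empty_iff_false, if_false]
    refine (Finset.sum_le_card_nsmul _ _ (515 * d) fun v _ => ?_).trans_eq ?_
    · rw [hψ1]
      have := mul_le_mul_of_nonneg_left (hdist v) (show 0 ≤ (1 + 1 / d) / 2 by positivity)
      linarith
    · rw [nsmul_eq_mul, Finset.card_univ]; ring
  -- `X` is moved to act first, because the `Z` string is exact on vectors with ancillas `|0⟩`. The
  -- errors are `8d` from `X` and `2d` from the original stabiliser.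
  have hstab (v : V) : ‖Q.qstr (vertexQuery G v) ψ - ψ‖ ≤ 10 * d := by
    have hcomm : Q.qstr (vertexQuery G v) = Q.qstr (nbrQuery G v) * Q.obs v .X := by
      rw [qstr_vertexQuery]
      exact (Q.qstr_commute_obs (by simp [nbrQuery]) _).eq.symm
    have hcomm' : P.qstr (vertexQuery G v) = P.qstr (nbrQuery G v) * P.obs v .X := by
      rw [qstr_vertexQuery]
      exact (P.qstr_commute_obs (by simp [nbrQuery]) _).eq.symm
    have hN (φ : H) : Q.qstr (nbrQuery G v) (Ext.incl φ) = Ext.incl (P.qstr (nbrQuery G v) φ) := by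
      refine (P.str_intertwine Q Ext.incl (fun w φ => ?_) φ).symm
      by_cases h : G.Adj v w <;> simp [nbrQuery, h, queryPoly, hZ]
    have heq : Q.qstr (vertexQuery G v) ψ - ψ =
        Q.qstr (nbrQuery G v) (Q.obs v .X ψ - Ext.incl (P.obs v .X P.state)) +
          Ext.incl (P.qstr (vertexQuery G v) P.state - P.state) := by
      rw [hcomm, hcomm', map_sub, hN, Ext.incl_sub, mul_apply_eq_comp, mul_apply_eq_comp]
      abel
    rw [heq]
    refine (norm_add_le _ _).trans ?_
    rw [norm_qstr, Ext.norm_incl]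
    linarith [hX v, hs v]
  obtain ⟨g, hg, hg1, hgd⟩ := hQ.exists_stabilised hstab
  rw [hψ1] at hg1
  have hgd : ‖ψ - g‖ ≤ 5 * n * d := hgd.trans_eq (by ring)
  have hstate : |Q.weight x p ψ - Q.weight x p g| ≤ d + 50 * n ^ 2 * d := by
    have h := Q.abs_weight_sub_le x p ψ g hd hψ1.le hg1
    have h2 := mul_le_mul_of_nonneg_left (pow_le_pow_left₀ (norm_nonneg _) hgd 2)
      (show 0 ≤ 1 + 1 / d by positivity)
    have h3 := mul_le_mul_of_nonneg_left hinv (show 0 ≤ 25 * n ^ 2 by positivity)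
    linarith
  have hhon : |Q.weight x p g - (honest G θ).outcomeProb p x| ≤ 10 * n * d := by
    rw [hQ.weight_eq_honest hg]
    have h0 := (honest G θ).outcomeProb_nonneg x p
    have h1 := (honest G θ).outcomeProb_le_one x p
    have h2 : 1 - ‖g‖ ≤ 5 * n * d := by
      have := norm_sub_norm_le ψ g
      linarith
    have h3 : 1 - ‖g‖ ^ 2 ≤ 10 * n * d := by linarith [sq_nonneg (1 - ‖g‖)]
    have h4 : 0 ≤ 1 - ‖g‖ ^ 2 := sub_nonneg.mpr (pow_le_one₀ (norm_nonneg g) hg1)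
    have h5 := mul_nonneg h4 h0
    have h6 := mul_le_of_le_one_right h4 h1
    rw [abs_le]
    constructor <;> linarith
  have hn2 : n * d ≤ n ^ 2 * d := mul_le_mul_of_nonneg_right (le_self_pow₀ hn two_ne_zero) hd.le
  have hn1 : d ≤ n ^ 2 * d := le_mul_of_one_le_left hd.le (one_le_pow₀ hn)
  -- In units of `n² d` the losses are at most `515` (observables), `1 + 50` (moving the state to
  -- `g`) and `10` (norm of `g`).
  rw [abs_le] at hhyb hstate hhon ⊢
  constructor <;> linarith

theorem single_le_sum_of_nonneg {ι : Type*} {s : Finset ι} {f : ι → ℝ} (hf : ∀ i, 0 ≤ f i) {i : ι}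
    (hi : i ∈ s) : f i ≤ ∑ j ∈ s, f j :=
  Finset.single_le_sum (fun j _ => hf j) hi

end Provers

/-! ### Numerical bounds and the main theorem. -/

theorem numSubtests_le {V : Type*} [Fintype V] [Nonempty V] {G : SimpleGraph V}
    {T : Finset (Finset V)} (hT : ∀ τ ∈ T, G.IsNClique 3 τ) :
    (numSubtests T : ℝ) ≤ 4 * (Fintype.card V : ℝ) ^ 3 := by
  have h : T.card ≤ Fintype.card V ^ 3 := by
    calc T.card ≤ (Finset.powersetCard 3 (Finset.univ : Finset V)).card :=
          Finset.card_le_card fun τ hτ =>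
            Finset.mem_powersetCard.mpr ⟨Finset.subset_univ _, (hT τ hτ).card_eq⟩
      _ = (Fintype.card V).choose 3 := by rw [Finset.card_powersetCard, Finset.card_univ]
      _ ≤ _ := Nat.choose_le_pow _ _
  have h1 : Fintype.card V ≤ Fintype.card V ^ 3 := Nat.le_self_pow (by norm_num) _
  have h2 : numSubtests T ≤ 4 * Fintype.card V ^ 3 := by unfold numSubtests; omega
  exact_mod_cast h2

/-- There is much slack: `δ ^ 8` is weakened to `δ ^ 2`, `17.7` to `17`, and, after `N` absorbs `n ^
3`, `n ^ 8` to `n ^ 4`. -/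
theorem gap_le {N n δ : ℝ} (hn : 1 ≤ n) (hN : N ≤ 4 * n ^ 3) (hδ : 0 ≤ δ) (hδ1 : δ ≤ 1) :
    N * (δ ^ 8 / ((10 : ℝ) ^ (17.7 : ℝ) * n ^ 11)) ≤ (δ / (1000 * n ^ 2)) ^ 2 := by
  have h10 : (10 : ℝ) ^ 17 ≤ (10 : ℝ) ^ (17.7 : ℝ) := by
    rw [← Real.rpow_natCast]
    exact Real.rpow_le_rpow_of_exponent_le (by norm_num) (by norm_num)
  have h8 : δ ^ 8 ≤ δ ^ 2 := pow_le_pow_of_le_one hδ hδ1 (by norm_num)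
  calc N * (δ ^ 8 / ((10 : ℝ) ^ (17.7 : ℝ) * n ^ 11))
      ≤ 4 * n ^ 3 * (δ ^ 2 / ((10 : ℝ) ^ 17 * n ^ 11)) := by gcongr
    _ = (4 / 10 ^ 17) * (δ ^ 2 / n ^ 8) := by field_simp
    _ ≤ (1 / 1000 ^ 2) * (δ ^ 2 / n ^ 4) :=
        mul_le_mul (by norm_num) (by gcongr; norm_num) (by positivity) (by norm_num)
    _ = _ := by field_simp

end OneShotTest
open OneShotTest in
theorem mainTheorem7 {V : Type*} [Fintype V] [DecidableEq V] [Nonempty V]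
    (G : SimpleGraph V) [DecidableRel G.Adj]
    (T : Finset (Finset V)) (hT : ∀ τ ∈ T, G.IsNClique 3 τ) (hcover : ∀ v, ∃ τ ∈ T, v ∈ τ)
    (nb : V → V) (hnb : ∀ v, G.Adj v (nb v))
    (θ : V → ℝ) (hθ : ∀ v, 0 ≤ θ v ∧ θ v ≤ Real.pi / 2) :
    acceptProb G T nb θ (honest G θ) = cTest T θ ∧
    ∀ (H : Type*) [NormedAddCommGroup H] [InnerProductSpace ℂ H] [CompleteSpace H]
      (P : Provers V H) (δ : ℝ), 0 ≤ δ →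
      (∃ (Ω : Type*) (p : Pattern V Ω) (x : Ω), p.QueriesOnce ∅ ∧
        δ < |P.outcomeProb p x - (honest G θ).outcomeProb p x|) →
      acceptProb G T nb θ P ≤
        cTest T θ - δ ^ 8 / ((10 : ℝ) ^ (17.7 : ℝ) * (Fintype.card V : ℝ) ^ 11) := by
  have hsin (v : V) : 0 ≤ |Real.sin (θ v)| := abs_nonneg _
  have hcos (v : V) : 0 ≤ Real.cos (θ v) :=
    Real.cos_nonneg_of_neg_pi_div_two_le_of_le (by linarith [(hθ v).1, Real.pi_pos]) (hθ v).2
  have hcs (v : V) : 0 < Real.cos (θ v) + |Real.sin (θ v)| := by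
    have h := Real.sin_sq_add_cos_sq (θ v)
    rw [← sq_abs (Real.sin (θ v))] at h
    nlinarith [hsin v, hcos v]
  refine ⟨(honest_isPauli G θ).acceptProb_eq G (honest_stabilizer G θ) T hT nb hnb hθ hcs, ?_⟩
  intro H _ _ _ P δ hδ ⟨Ω, p, x, hp, hdiff⟩
  have hN := Provers.numSubtests_pos (V := V) T
  have hD := P.deficit_eq G T nb θ hcs
  have h1 (v : V) : 0 ≤ P.stabErr G v / 4 := by unfold Provers.stabErr; positivity
  have h2 (τ : Finset V) : 0 ≤ P.triangleErr G τ / 4 := by unfold Provers.triangleErr; positivity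
  have h3 (v : V) : 0 ≤ P.rotErr G nb θ v / (4 * (Real.cos (θ v) + |Real.sin (θ v)|)) :=
    div_nonneg (P.rotErr_nonneg G nb θ v) (by linarith [hcs v])
  have hs1 := Finset.sum_nonneg fun v (_ : v ∈ Finset.univ) => h1 v
  have hs2 := Finset.sum_nonneg fun τ (_ : τ ∈ T) => h2 τ
  have hs3 := Finset.sum_nonneg fun v (_ : v ∈ Finset.univ) => h3 v
  -- The estimates divide by `d`, so `δ = 0` is separate; there nonnegativity of the squared errors
  -- suffices.
  rcases hδ.eq_or_lt with rfl | hδ0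
  · have : 0 ≤ cTest T θ - acceptProb G T nb θ P :=
      nonneg_of_mul_nonneg_right (by rw [hD]; linarith) hN
    simpa using this
  by_contra! hacc
  have hδ1 : δ ≤ 1 := by
    refine hdiff.le.trans (abs_sub_le_iff.mpr ⟨?_, ?_⟩)
    · linarith [P.outcomeProb_le_one x p, (honest G θ).outcomeProb_nonneg x p]
    · linarith [P.outcomeProb_nonneg x p, (honest G θ).outcomeProb_le_one x p]
  have hn : (1 : ℝ) ≤ Fintype.card V := by exact_mod_cast Fintype.card_pos
  set n : ℝ := (Fintype.card V : ℝ) with hndef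
  set d := δ / (1000 * n ^ 2) with hd
  have hd0 : 0 < d := by positivity
  have hd1 : d ≤ 1 := by
    rw [hd, div_le_one (by positivity)]
    nlinarith
  have hgap : numSubtests T * (cTest T θ - acceptProb G T nb θ P) ≤ d ^ 2 := by
    refine le_trans ?_ (gap_le hn (numSubtests_le hT) hδ hδ1)
    gcongr
    linarith
  rw [hD] at hgap
  have hstab (v : V) : ‖P.qstr (vertexQuery G v) P.state - P.state‖ ≤ 2 * d := by
    have h := Provers.single_le_sum_of_nonneg h1 (Finset.mem_univ v)
    refine (sq_le_sq₀ (norm_nonneg _) (by positivity)).mp ?_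
    change P.stabErr G v ≤ _
    linarith
  have htri (τ : Finset V) (hτ : τ ∈ T) :
      ‖P.qstr (triangleQuery G τ) P.state + P.state‖ ≤ 2 * d := by
    have h := Provers.single_le_sum_of_nonneg h2 hτ
    refine (sq_le_sq₀ (norm_nonneg _) (by positivity)).mp ?_
    change P.triangleErr G τ ≤ _
    linarith
  -- From `cos + |sin| ≤ 2` the error is at most `8d²`, rounded up to a square.
  have hrot (v : V) : P.rotErr G nb θ v ≤ (3 * d) ^ 2 := by
    have h := Provers.single_le_sum_of_nonneg h3 (Finset.mem_univ v)
    have hle : P.rotErr G nb θ v / (4 * (Real.cos (θ v) + |Real.sin (θ v)|)) ≤ d ^ 2 := by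
      linarith
    rw [div_le_iff₀ (by linarith [hcs v])] at hle
    nlinarith [Real.cos_le_one (θ v), Real.abs_sin_le_one (θ v), sq_nonneg d]
  have hanti (v : V) :
      ‖P.obs v .X (P.obs v .Z P.state) + P.obs v .Z (P.obs v .X P.state)‖ ≤ 8 * d := by
    obtain ⟨τ, hτ, hv⟩ := hcover v
    exact (P.norm_anticommutator_le G hstab (hT τ hτ) hv (htri τ hτ)).trans_eq (by ring)
  have h := Provers.abs_outcomeProb_sub_honest_le hd0 hd1 hstab hanti
    (fun v t => Provers.norm_rot_sub_le hnb hθ hstab v (hrot v) hd0.le t) p x hp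
  have : 600 * n ^ 2 * d = 3 / 5 * δ := by rw [hd]; field_simp; norm_num
  linarith
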